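/- Let $\mathbb F$ be an arbitrary field and $d>0$. For $N\ge 1$ let $\mathrm{Sym}_N(\mathbb F^*)$ be the set of symmetric $N\times N$ matrices all of whose entries are non-zero elements of $\mathbb F$. **Frozen variables and types.** For a matrix $A\in\mathbb F^{m\times n}$, a column index $i\in[n]$ is *frozen* in $A$ if there is a row vector $y\in\mathbb F^{1\times m}$ with $\mathrm{supp}(yA)=\{i\}$; let $\mathcal F(A)$ be the set of frozen indices. Let $A\langle i;\rangle$ be $A$ with row $i$ deleted (other labels kept). For $i\in[\min(m,n)]$ call $i$ *frailly frozen* in $A$ if $i\in\mathcal F(A)\setminus\mathcal F(A\langle i;\rangle)$, *firmly frozen* in $A$ if $i\in\mathcal F(A\langle i;\rangle)$, and *completely frozen* in $A$ if it is firmly frozen in both $A$ and $A^T$. Let $\mathcal X(A)$, $\mathcal Y(A)$, $\mathcal Z(A)$, $\mathcal U(A)$, $\mathcal V(A)$ be the sets of $i\in[\min(m,n)]$ that are, respectively: frailly frozen in $A$; completely frozen in $A$; frozen neither in $A$ nor in $A^T$; not frozen in $A$ but firmly frozen in $A^T$; firmly frozen in $A$ but not frozen in $A^T$. **Random matrices.**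 Let $(\boldsymbol q(i,j))_{i,j\ge1}$ be i.i.d. uniform on $[0,1]$. For $N\ge1$ and $J_N\in\mathrm{Sym}_N(\mathbb F^*)$ let $\boldsymbol\tau$ be a uniform permutation of $[N]$. For $p\ge 0$ and $n\le N$ let $\boldsymbol T_{n,p}=\boldsymbol T_{n,p}^{(N)}\in\mathbb F^{n\times n}$ be the symmetric matrix with zero diagonal and $$\boldsymbol T_{n,p}(i,j)=\mathbf 1\{\boldsymbol q(\boldsymbol\tau(i),\boldsymbol\tau(j))<p\}\,J_N(\boldsymbol\tau(i),\boldsymbol\tau(j)),\qquad i<j.$$ **Perturbation.** Let $(\boldsymbol u_{k,\ell})_{k,\ell\ge1}$ be independent with $\boldsymbol u_{k,\ell}$ uniform on $[\ell]$, and put $\boldsymbol j_{k,n}=\max\{\ell\in[n]:\boldsymbol u_{k,\ell}=\ell\}$; thus, for each $n$, $\boldsymbol j_{1,n},\boldsymbol j_{2,n},\dots$ are i.i.d. uniform on $[n]$. Let $(\boldsymbol i_{k,n})_{k,n\ge1}$ be an independent copy of the array $(\boldsymbol j_{k,n})_{k,n\ge 1}$. For $P\ge1$ let $\boldsymbol\theta=(\boldsymbol\theta_r,\boldsymbol\theta_c)$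 be uniform on $[P]^2$. All of $\boldsymbol q$, $\boldsymbol\tau$, $\boldsymbol\theta$, $(\boldsymbol j_{k,n})$, $(\boldsymbol i_{k,n})$ are independent. For $A\in\mathbb F^{n\times n}$ set $$A[\boldsymbol\theta]=\begin{pmatrix}A&\boldsymbol\Theta_c\\ \boldsymbol\Theta_r&0\end{pmatrix}\in\mathbb F^{(n+\boldsymbol\theta_r)\times(n+\boldsymbol\theta_c)},$$ where row $k\in[\boldsymbol\theta_r]$ of $\boldsymbol\Theta_r$ has a single non-zero entry, equal to $1$, in column $\boldsymbol j_{k,n}$, and column $k\in[\boldsymbol\theta_c]$ of $\boldsymbol\Theta_c$ has a single non-zero entry, equal to $1$, in row $\boldsymbol i_{k,n}$. **Proportions.** For $(w,\mathcal W)\in\{(x,\mathcal X),(y,\mathcal Y),(z,\mathcal Z),(u,\mathcal U),(v,\mathcal V)\}$ and $1\le m\le N$ set $\boldsymbol w_{m,p}=\frac1m\left|\mathcal W(\boldsymbol T_{m,p}[\boldsymbol\theta])\cap[m]\right|$, and let $\boldsymbol\zeta_{m,p}=(\boldsymbol x_{m,p},\boldsymbol y_{m,p},\boldsymbol z_{m,p},\boldsymbol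 u_{m,p},\boldsymbol v_{m,p})$. **Proposition (stability of types).** For each $\boldsymbol w\in\{\boldsymbol x,\boldsymbol y,\boldsymbol z,\boldsymbol u,\boldsymbol v,\boldsymbol\zeta\}$, $\mathbb E\|\boldsymbol w_{n,t/n}-\boldsymbol w_{n+1,t/n}\|_1=o_{n,P}(1)$ uniformly in $t\in[0,d]$, that is, $$\limsup_{P\to\infty}\ \limsup_{n\to\infty}\ \sup_{N\ge n+1}\ \sup_{J_N\in\mathrm{Sym}_N(\mathbb F^*)}\ \sup_{t\in[0,d]}\ \mathbb E\big\|\boldsymbol w_{n,t/n}-\boldsymbol w_{n+1,t/n}\big\|_1=0 .$$ -/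

import Mathlib

open MeasureTheory ProbabilityTheory Filter
open scoped ENNReal Matrix

noncomputable section

namespace SymRank

/-! ### Frozen variables and types -/

section Types

variable {ρ κ ι F : Type*} [Field F]

/-- `I` is a relation of `A`: `∅ ≠ supp (y A) ⊆ I` for some row vector `y`. -/
def IsRelation [Fintype ρ] (A : Matrix ρ κ F) (I : Set κ) : Prop :=
  I.Nonempty ∧ ∃ y : ρ → F,
    (Function.support (y ᵥ* A)).Nonempty ∧ Function.support (y ᵥ* A) ⊆ I

/-- The set `𝓕(A)` of frozen variables (column indices) of `A`. -/
def frozen [Fintype ρ] (A : Matrix ρ κ F) : Set κ :=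
  {j | IsRelation A {j}}

/-- The matrix obtained from `A` by deleting row `i`; the other labels are kept. -/
def removeRow (A : Matrix ρ κ F) (i : ρ) : Matrix {k : ρ // k ≠ i} κ F :=
  A.submatrix Subtype.val id

/-!
In the definitions below, `ι` is a set of labels shared by rows and columns: `i : ι` labels the row
`Sum.inl i` and the column `Sum.inl i`.
-/

variable {σ : Type*} [Fintype ι] [DecidableEq ι] [Fintype ρ] [DecidableEq ρ]
  [Fintype σ] [DecidableEq σ]

/-- `i` is frailly frozen: frozen in `A`, but no longer frozen after deletion of row `i`. -/
def FraillyFrozen (A : Matrix (ι ⊕ ρ) (ι ⊕ σ) F) (i : ι) : Prop :=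
  Sum.inl i ∈ frozen A \ frozen (removeRow A (Sum.inl i))

/-- `i` is firmly frozen: frozen even after deletion of row `i`. -/
def FirmlyFrozen (A : Matrix (ι ⊕ ρ) (ι ⊕ σ) F) (i : ι) : Prop :=
  Sum.inl i ∈ frozen (removeRow A (Sum.inl i))

/-- `i` is completely frozen: firmly frozen in both `A` and its transpose. -/
def CompletelyFrozen (A : Matrix (ι ⊕ ρ) (ι ⊕ σ) F) (i : ι) : Prop :=
  FirmlyFrozen A i ∧ FirmlyFrozen Aᵀ i

/-- The labels `i : ι` of type `𝓧` (frailly frozen). -/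
def typeX (A : Matrix (ι ⊕ ρ) (ι ⊕ σ) F) : Set ι := {i | FraillyFrozen A i}

/-- The labels of type `𝓨` (completely frozen). -/
def typeY (A : Matrix (ι ⊕ ρ) (ι ⊕ σ) F) : Set ι := {i | CompletelyFrozen A i}

/-- The labels of type `𝓩` (frozen neither in `A` nor in `Aᵀ`). -/
def typeZ (A : Matrix (ι ⊕ ρ) (ι ⊕ σ) F) : Set ι :=
  {i | Sum.inl i ∉ frozen A ∧ Sum.inl i ∉ frozen Aᵀ}

/-- The labels of type `𝓤` (not frozen in `A`, firmly frozen in `Aᵀ`). -/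
def typeU (A : Matrix (ι ⊕ ρ) (ι ⊕ σ) F) : Set ι :=
  {i | Sum.inl i ∉ frozen A ∧ FirmlyFrozen Aᵀ i}

/-- The labels of type `𝓥` (firmly frozen in `A`, not frozen in `Aᵀ`). -/
def typeV (A : Matrix (ι ⊕ ρ) (ι ⊕ σ) F) : Set ι :=
  {i | FirmlyFrozen A i ∧ Sum.inl i ∉ frozen Aᵀ}

end Types

section Proportions

variable {F : Type*} [Field F] {n r c : ℕ}

/-! Proportions of the types among the `n` labels shared by rows and columns. -/

def propX (A : Matrix (Fin n ⊕ Fin r) (Fin n ⊕ Fin c) F) : ℝ := ((typeX A).ncard : ℝ) / n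

def propY (A : Matrix (Fin n ⊕ Fin r) (Fin n ⊕ Fin c) F) : ℝ := ((typeY A).ncard : ℝ) / n

def propZ (A : Matrix (Fin n ⊕ Fin r) (Fin n ⊕ Fin c) F) : ℝ := ((typeZ A).ncard : ℝ) / n

def propU (A : Matrix (Fin n ⊕ Fin r) (Fin n ⊕ Fin c) F) : ℝ := ((typeU A).ncard : ℝ) / n

def propV (A : Matrix (Fin n ⊕ Fin r) (Fin n ⊕ Fin c) F) : ℝ := ((typeV A).ncard : ℝ) / n

/-- The vector `(x, y, z, u, v)` of all proportions, in `ℝ⁵` with the `ℓ¹`-norm. -/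
def propZeta (A : Matrix (Fin n ⊕ Fin r) (Fin n ⊕ Fin c) F) : PiLp 1 (fun _ : Fin 5 => ℝ) :=
  WithLp.toLp 1 ![propX A, propY A, propZ A, propU A, propV A]

end Proportions

/-! ### The random matrices -/

/-- Symmetric `N × N` matrices all of whose entries are non-zero. -/
def Template (F : Type*) [Field F] (N : ℕ) : Type _ :=
  {J : Matrix (Fin N) (Fin N) F // J.IsSymm ∧ ∀ i j, J i j ≠ 0}

/-- The `n × n` matrix `T_{n,p}^{(N)}` built from the template `J`, the numbers `q (i, j)` and the
permutation `τ` of the `N` labels. Labels start at `0`. -/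
def matT {F : Type*} [Field F] {N : ℕ} (J : Template F N) (q : ℕ × ℕ → unitInterval)
    (τ : Equiv.Perm (Fin N)) (p : ℝ) (n : ℕ) (hn : n ≤ N) : Matrix (Fin n) (Fin n) F :=
  Matrix.of fun i j =>
    let a := τ (Fin.castLE hn i)
    let b := τ (Fin.castLE hn j)
    if i < j then (if (q (a, b) : ℝ) < p then J.1 a b else 0)
    else if j < i then (if (q (b, a) : ℝ) < p then J.1 b a else 0)
    else 0

/-- Numbers `u (k, l) ∈ {0, …, l}`, for `k, l ∈ ℕ`. -/
abbrev HitArray : Type := (i : ℕ × ℕ) → Fin (i.2 + 1)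

/-- The largest `l ∈ {0, …, n - 1}` with `u (k, l) = l` (for `n ≥ 1` one has `u (k, 0) = 0`). -/
def lastHit (u : HitArray) (k n : ℕ) : ℕ :=
  ((Finset.range n).filter fun l => (u (k, l) : ℕ) = l).sup id

/-- The row-perturbation matrix `Θ_r[θ, n₁ | n₂]`: row `k` has its unique `1` in column
`lastHit u k n₁`. For `u` with independent entries, `u (k, l)` uniform on `{0, …, l}`, these
columns are independent and uniform on `{0, …, n₁ - 1}`, and the matrices are coupled for all
sizes. -/
def rowPert (F : Type*) [Field F] (u : HitArray) (θ n₁ n₂ : ℕ) : Matrix (Fin θ) (Fin n₂) F :=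
  Matrix.of fun k j => if (j : ℕ) = lastHit u k n₁ then 1 else 0

/-- The column-perturbation matrix `Θ_c[m₁ | m₂, θ]`. -/
def colPert (F : Type*) [Field F] (u : HitArray) (m₁ m₂ θ : ℕ) : Matrix (Fin m₂) (Fin θ) F :=
  Matrix.of fun i k => if (i : ℕ) = lastHit u k m₁ then 1 else 0

/-- The perturbed matrix `A[θ]`, `θ = (θ_r, θ_c)`, with row perturbation driven by `ur` and column
perturbation driven by `uc`. -/
def perturb {F : Type*} [Field F] {m n : ℕ} (A : Matrix (Fin m) (Fin n) F) (θ : ℕ × ℕ)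
    (ur uc : HitArray) : Matrix (Fin m ⊕ Fin θ.1) (Fin n ⊕ Fin θ.2) F :=
  Matrix.fromBlocks A (colPert F uc m m θ.2) (rowPert F ur θ.1 n n) 0

/-! ### The underlying probability space -/

instance permMeasurableSpace (N : ℕ) : MeasurableSpace (Equiv.Perm (Fin N)) := ⊤

/-- Sample points `(q, τ, θ, ur, uc)`. -/
abbrev Outcome (N : ℕ) : Type :=
  (ℕ × ℕ → unitInterval) × Equiv.Perm (Fin N) × (ℕ × ℕ) × HitArray × HitArray

/-- The law of an array of independent `u (k, l)`, each uniform on `{0, …, l}`. -/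
def hitLaw : Measure HitArray :=
  Measure.infinitePi fun i : ℕ × ℕ => uniformOn (Set.univ : Set (Fin (i.2 + 1)))

/-- The joint law: `q` is an array of i.i.d. uniform variables on `[0, 1]`, `τ` a uniform
permutation of the `N` labels, `θ` uniform on `{1, …, P}²`, `ur` and `uc` are distributed according
to `hitLaw`, and the five objects are independent. -/
def law (N P : ℕ) : Measure (Outcome N) :=
  (Measure.infinitePi fun _ : ℕ × ℕ => (volume : Measure unitInterval)).prod
    ((uniformOn (Set.univ : Set (Equiv.Perm (Fin N)))).prod
      ((uniformOn (Set.Icc 1 P ×ˢ Set.Icc 1 P : Set (ℕ × ℕ))).prod (hitLaw.prod hitLaw)))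

/-- The random matrix `T_{n,p}^{(N)}[θ]`. -/
def matTθ {F : Type*} [Field F] {N : ℕ} (J : Template F N) (p : ℝ) (n : ℕ) (hn : n ≤ N)
    (ω : Outcome N) : Matrix (Fin n ⊕ Fin ω.2.2.1.1) (Fin n ⊕ Fin ω.2.2.1.2) F :=
  perturb (matT J ω.1 ω.2.1 p n hn) ω.2.2.1 ω.2.2.2.1 ω.2.2.2.2

/-- `𝔼 ‖w(T_{n,t/n}[θ]) - w(T_{n+1,t/n}[θ])‖` for a matrix statistic `w`. -/
def expectedChange {F E : Type*} [Field F] [NormedAddCommGroup E]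
    (w : ∀ {n r c : ℕ}, Matrix (Fin n ⊕ Fin r) (Fin n ⊕ Fin c) F → E)
    (n P N : ℕ) (hN : n + 1 ≤ N) (J : Template F N) (t : ℝ) : ℝ≥0∞ :=
  ∫⁻ ω, ‖w (matTθ J (t / n) n (n.le_succ.trans hN) ω) - w (matTθ J (t / n) (n + 1) hN ω)‖ₑ
    ∂(law N P)

/-- `a_{n,P,N,J,t} = o_{n,P}(1)` uniformly in `t ∈ [0, d]`, for a non-negative family `a` that is
defined for `N ≥ n + 1`. -/
def IsLittleOneNP {F : Type*} [Field F] (d : ℝ)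
    (a : (n P N : ℕ) → n + 1 ≤ N → Template F N → ℝ → ℝ≥0∞) : Prop :=
  limsup (fun P : ℕ => limsup (fun n : ℕ =>
    ⨆ (N : ℕ) (hN : n + 1 ≤ N) (J : Template F N) (t : ℝ) (_ : t ∈ Set.Icc 0 d),
      a n P N hN J t) atTop) atTop = 0

end SymRank

end

/-! Write `T` for the unperturbed matrix. The unit rows of `Θ_r` make the columns in their hit set
`R` irrelevant, and the unit columns of `Θ_c` forbid the use of the rows in their hit set `C`. Being
frozen in `A[θ]` therefore depends only on `T`, `R` and `C` (`FrozenMod`), and it is increasing in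
`R` and decreasing in `C`. Firmly frozen is the same notion with `i` added to `C`; transposing swaps
`R` and `C`, because `T` is symmetric. Each type is a Boolean combination of these four statuses.

Passing from `n` to `n + 1` borders `T` by a row and a column supported in a random set `S`. The old
and the new status of a label both lie between "frozen modulo `(R, C ∪ S)`" and "frozen modulo `(R ∪
S, C)`" (`mem_gap_of_border`), so the number of changes is at most the size of the gap between these
two sets.

If `S` consisted of `k` independent uniform indices, `R ∪ S` would be the hit set of a longer
perturbation. With `H a b` the mean number of frozen labels for perturbation sizes `(a, b)`, the
mean gap is `H (a + k) b - H a (b + k)`. Summed over `(a, b)` in `{1, …, P}²` this telescopes to at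
most `2kPn` (`sum_tupleAvg_gap_le`); dividing by `P²n` leaves `2k / P`.

The true `S` is independent of `T` and covers a given `s` with probability at most `p ^ |s|`. As `pn
≤ d`, its law is dominated by the mixture of uniform `k`-tuples with weights `d ^ k / k!`
(`lintegral_matT_newSupport_le`), and `∑ k d ^ k / k! ≤ d e ^ d`. Finally, the perturbation itself
moves with probability at most `2P / (n + 1)`. -/

namespace SymRank

/-! ### Frozen status as a monotone function of two index sets. -/

section FrozenModulo

variable {F : Type*} [Field F]

lemma mem_frozen_iff {ρ κ : Type*} [Fintype ρ] [DecidableEq κ] (A : Matrix ρ κ F) (j : κ) :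
    j ∈ frozen A ↔ ∃ y : ρ → F, y ᵥ* A = Pi.single j 1 := by
  constructor
  · rintro ⟨-, y, ⟨k, hk⟩, hsub⟩
    have hkj : k = j := hsub hk
    subst hkj
    refine ⟨((y ᵥ* A) k)⁻¹ • y, ?_⟩
    ext l
    rw [Matrix.smul_vecMul, Pi.smul_apply, smul_eq_mul]
    by_cases hl : l = k
    · subst hl
      rw [Pi.single_eq_same]
      exact inv_mul_cancel₀ hk
    · have : (y ᵥ* A) l = 0 := by
        by_contra h
        exact hl (hsub h)
      rw [this, mul_zero, Pi.single_eq_of_ne hl]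
  · rintro ⟨y, hy⟩
    refine ⟨Set.singleton_nonempty j, y, ⟨j, ?_⟩, fun l hl => ?_⟩
    · simp [hy]
    · by_contra h
      exact hl (by rw [hy]; exact Pi.single_eq_of_ne h 1)

/-- Deleting a row amounts to forcing its coefficient to vanish, so firm freezing becomes one more
linear constraint on `y`. -/
lemma mem_frozen_removeRow_iff {ρ κ : Type*} [Fintype ρ] [DecidableEq ρ] [DecidableEq κ]
    (A : Matrix ρ κ F) (i : ρ) (j : κ) :
    j ∈ frozen (removeRow A i) ↔ ∃ y : ρ → F, y ᵥ* A = Pi.single j 1 ∧ y i = 0 := by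
  have key : ∀ y : ρ → F, y i = 0 →
      (fun k : {k : ρ // k ≠ i} => y k) ᵥ* removeRow A i = y ᵥ* A := by
    intro y hy
    ext l
    simp only [Matrix.vecMul, dotProduct, removeRow, Matrix.submatrix_apply, id]
    rw [← Finset.add_sum_erase _ _ (Finset.mem_univ i), hy, zero_mul, zero_add]
    exact (Finset.sum_subtype _ (fun k => by simp) fun k => y k * A k l).symm
  rw [mem_frozen_iff]
  constructor
  · rintro ⟨y, hy⟩
    let y' : ρ → F := fun k => if h : k ≠ i then y ⟨k, h⟩ else 0
    have h0 : y' i = 0 := by simp [y']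
    refine ⟨y', ?_, h0⟩
    rw [← key y' h0, ← hy]
    congr 1
    ext k
    simp [y', k.2]
  · rintro ⟨y, hy, h0⟩
    exact ⟨_, (key y h0).trans hy⟩

/-- The unit vector at `i` is a combination of the rows of `T` outside `C`, up to the columns
in `R`. -/
def FrozenMod {ι : Type*} [Fintype ι] [DecidableEq ι] (T : Matrix ι ι F) (R C : Finset ι)
    (i : ι) : Prop :=
  ∃ y : ι → F, (∀ k ∈ C, y k = 0) ∧ ∀ j ∉ R, (y ᵥ* T) j = (Pi.single i 1 : ι → F) j

/-- An element of `R` removes an equation and an element of `C` adds one. This monotonicity drives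
the whole sandwich argument. -/
lemma FrozenMod.mono {ι : Type*} [Fintype ι] [DecidableEq ι] {T : Matrix ι ι F}
    {R R' C C' : Finset ι} {i : ι} (h : FrozenMod T R C i) (hR : R ⊆ R') (hC : C' ⊆ C) :
    FrozenMod T R' C' i := by
  obtain ⟨y, h1, h2⟩ := h
  exact ⟨y, fun k hk => h1 k (hC hk), fun j hj => h2 j fun h => hj (hR h)⟩

/-- The positions of the unit entries in the first `θ` perturbation rows. -/
def hitSet (u : HitArray) (θ n : ℕ) : Finset (Fin n) :=
  {j | ∃ k : Fin θ, (j : ℕ) = lastHit u k n}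

lemma mem_hitSet {u : HitArray} {θ n : ℕ} {j : Fin n} :
    j ∈ hitSet u θ n ↔ ∃ k : Fin θ, (j : ℕ) = lastHit u k n := by
  simp [hitSet]

/-- The perturbation rows are unit vectors, hence they correct any error located on the hit columns.
-/
lemma exists_vecMul_rowPert (u : HitArray) (θ n : ℕ) (z : Fin n → F)
    (hz : ∀ j ∉ hitSet u θ n, z j = 0) : ∃ y : Fin θ → F, y ᵥ* rowPert F u θ n n = z := by
  classical
  have single : ∀ j ∈ hitSet u θ n, ∃ y : Fin θ → F, y ᵥ* rowPert F u θ n n = Pi.single j 1 := by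
    intro j hj
    obtain ⟨k, hk⟩ := mem_hitSet.1 hj
    refine ⟨Pi.single k 1, ?_⟩
    rw [Matrix.single_one_vecMul]
    ext l
    simp only [rowPert, Matrix.row, Matrix.of_apply, ← hk, Pi.single_apply, Fin.ext_iff]
  choose! Y hY using single
  refine ⟨∑ j ∈ hitSet u θ n, z j • Y j, ?_⟩
  rw [Matrix.sum_vecMul]
  simp_rw [Matrix.smul_vecMul]
  rw [Finset.sum_congr rfl fun j hj => by rw [hY j hj]]
  ext l
  by_cases hl : l ∈ hitSet u θ n
  · simp [Finset.sum_apply, Pi.single_apply, hl]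
  · simp [Finset.sum_apply, Pi.single_apply, hl, hz l hl]

lemma vecMul_rowPert_eq_zero (u : HitArray) (θ n : ℕ) (y : Fin θ → F) {j : Fin n}
    (hj : j ∉ hitSet u θ n) : (y ᵥ* rowPert F u θ n n) j = 0 := by
  rw [mem_hitSet, not_exists] at hj
  simp [Matrix.vecMul, dotProduct, rowPert, hj]

/-- Each perturbation column reads off one coordinate of `y`; `hu` ensures that its unit entry lies
inside the matrix. -/
lemma vecMul_colPert_eq_zero_iff {u : HitArray} {θ n : ℕ} (hu : ∀ k, lastHit u k n < n)
    (y : Fin n → F) :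
    y ᵥ* colPert F u n n θ = 0 ↔ ∀ k ∈ hitSet u θ n, y k = 0 := by
  have key : ∀ k : Fin θ, (y ᵥ* colPert F u n n θ) k = y ⟨lastHit u k n, hu k⟩ := by
    intro k
    simp only [Matrix.vecMul, dotProduct, colPert, Matrix.of_apply, mul_ite, mul_one, mul_zero]
    rw [Finset.sum_eq_single ⟨lastHit u k n, hu k⟩]
    · simp
    · intro b _ hb
      rw [if_neg fun h => hb (Fin.ext h)]
    · simp
  constructor
  · intro h k hk
    obtain ⟨l, hl⟩ := mem_hitSet.1 hk
    have := key l
    rw [h] at this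
    rw [Fin.ext (a := k) (b := ⟨lastHit u l n, hu l⟩) hl, ← this]
    rfl
  · intro h
    ext k
    rw [key k]
    exact h _ (mem_hitSet.2 ⟨k, rfl⟩)

/-- The extra set `D` treats two cases at once: `D = ∅` gives frozen, `D = {i}` gives firmly frozen.
-/
lemma exists_vecMul_perturb_iff {n : ℕ} (T : Matrix (Fin n) (Fin n) F) (θ : ℕ × ℕ)
    (ur uc : HitArray) (hc : ∀ k, lastHit uc k n < n) (D : Finset (Fin n)) (i : Fin n) :
    (∃ y, y ᵥ* perturb T θ ur uc = Pi.single (Sum.inl i) 1 ∧ ∀ k ∈ D, y (Sum.inl k) = 0) ↔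
      FrozenMod T (hitSet ur θ.1 n) (hitSet uc θ.2 n ∪ D) i := by
  have hs : (Pi.single (Sum.inl i) 1 : Fin n ⊕ Fin θ.2 → F) = Sum.elim (Pi.single i 1) 0 := by
    simp [Sum.elim_single_zero]
  constructor
  · rintro ⟨y, hy, hD⟩
    rw [perturb, Matrix.vecMul_fromBlocks, hs, Sum.elim_eq_iff, Matrix.vecMul_zero,
      add_zero, vecMul_colPert_eq_zero_iff hc] at hy
    refine ⟨y ∘ Sum.inl, fun k hk => ?_, fun j hj => ?_⟩
    · rcases Finset.mem_union.1 hk with hk | hk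
      exacts [hy.2 k hk, hD k hk]
    · rw [← hy.1, Pi.add_apply, vecMul_rowPert_eq_zero _ _ _ _ hj, add_zero]
  · rintro ⟨y, hC, hR⟩
    obtain ⟨y', hy'⟩ := exists_vecMul_rowPert (F := F) ur θ.1 n (Pi.single i 1 - y ᵥ* T)
      fun j hj => by rw [Pi.sub_apply, hR j hj, sub_self]
    refine ⟨Sum.elim y y', ?_, fun k hk => hC k (Finset.mem_union_right _ hk)⟩
    rw [perturb, Matrix.vecMul_fromBlocks, hs, Sum.elim_eq_iff, Matrix.vecMul_zero,
      add_zero, vecMul_colPert_eq_zero_iff hc, Sum.elim_comp_inl, Sum.elim_comp_inr, hy']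
    exact ⟨add_sub_cancel _ _, fun k hk => hC k (Finset.mem_union_left _ hk)⟩

lemma mem_frozen_perturb_iff {n : ℕ} (T : Matrix (Fin n) (Fin n) F) (θ : ℕ × ℕ)
    (ur uc : HitArray) (hc : ∀ k, lastHit uc k n < n) (i : Fin n) :
    Sum.inl i ∈ frozen (perturb T θ ur uc) ↔
      FrozenMod T (hitSet ur θ.1 n) (hitSet uc θ.2 n) i := by
  have := exists_vecMul_perturb_iff T θ ur uc hc ∅ i
  rw [mem_frozen_iff]
  simpa using this

lemma firmlyFrozen_perturb_iff {n : ℕ} (T : Matrix (Fin n) (Fin n) F) (θ : ℕ × ℕ)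
    (ur uc : HitArray) (hc : ∀ k, lastHit uc k n < n) (i : Fin n) :
    FirmlyFrozen (perturb T θ ur uc) i ↔
      FrozenMod T (hitSet ur θ.1 n) (hitSet uc θ.2 n ∪ {i}) i := by
  rw [FirmlyFrozen, mem_frozen_removeRow_iff, ← exists_vecMul_perturb_iff T θ ur uc hc]
  simp

lemma transpose_perturb {n : ℕ} (T : Matrix (Fin n) (Fin n) F) (θ : ℕ × ℕ) (ur uc : HitArray) :
    (perturb T θ ur uc)ᵀ = perturb Tᵀ θ.swap uc ur := by
  ext (i | i) (j | j) <;> rfl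

/-- Bordering by a row and a column supported in `S` loses at most what freeing the rows in `S`
loses. -/
lemma FrozenMod.border {n : ℕ} {B : Matrix (Fin (n + 1)) (Fin (n + 1)) F} {R C S : Finset (Fin n)}
    {i : Fin n} (hS : ∀ k ∉ S, B k.castSucc (Fin.last n) = 0)
    (h : FrozenMod (B.submatrix Fin.castSucc Fin.castSucc) R (C ∪ S) i) :
    FrozenMod B (R.map Fin.castSuccEmb) (C.map Fin.castSuccEmb) i.castSucc := by
  obtain ⟨y, hC, hR⟩ := h
  -- The new row gets coefficient `0`. The new column is then annihilated because `y` vanishes on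
  -- `S`, which contains its support above the last entry.
  refine ⟨Fin.snoc y 0, fun k hk => ?_, fun j hj => ?_⟩
  · obtain ⟨l, hl, rfl⟩ := Finset.mem_map.1 hk
    simpa using hC l (Finset.mem_union_left _ hl)
  · simp only [Matrix.vecMul, dotProduct, Fin.sum_univ_castSucc, Fin.snoc_castSucc, Fin.snoc_last,
      zero_mul, add_zero]
    induction j using Fin.lastCases with
    | last =>
      rw [Pi.single_eq_of_ne (Fin.castSucc_lt_last i).ne']
      refine Finset.sum_eq_zero fun k _ => ?_
      by_cases hk : k ∈ S
      · rw [hC k (Finset.mem_union_right _ hk), zero_mul]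
      · rw [hS k hk, mul_zero]
    | cast j =>
      have := hR j fun h => hj (Finset.mem_map.2 ⟨j, h, rfl⟩)
      simpa [Matrix.vecMul, dotProduct, Pi.single_apply] using this

/-- Bordering by a row and a column supported in `S` gains at most what fixing the columns in `S`
gains. -/
lemma FrozenMod.of_border {n : ℕ} {B : Matrix (Fin (n + 1)) (Fin (n + 1)) F}
    {R C S : Finset (Fin n)} {i : Fin n} (hS : ∀ k ∉ S, B (Fin.last n) k.castSucc = 0)
    (h : FrozenMod B (R.map Fin.castSuccEmb) (C.map Fin.castSuccEmb) i.castSucc) :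
    FrozenMod (B.submatrix Fin.castSucc Fin.castSucc) (R ∪ S) C i := by
  obtain ⟨y, hC, hR⟩ := h
  -- Dropping the coefficient of the new row alters only the columns in `S`, and these are ignored
  -- once `S` joins `R`.
  refine ⟨fun k => y k.castSucc, fun k hk => hC _ (Finset.mem_map.2 ⟨k, hk, rfl⟩), fun j hj => ?_⟩
  rw [Finset.mem_union, not_or] at hj
  have := hR j.castSucc (by simpa using hj.1)
  simpa [Matrix.vecMul, dotProduct, Pi.single_apply, Fin.sum_univ_castSucc, hS j hj.2] using this

end FrozenModulo

/-! ### Averages over uniform tuples and the telescoping bound. -/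

section TupleAverage

variable {ι : Type*} [Fintype ι] [DecidableEq ι]

/-- The average of `Φ` over the set of entries of a uniform `a`-tuple. -/
noncomputable def tupleAvg (a : ℕ) (Φ : Finset ι → ℝ≥0∞) : ℝ≥0∞ :=
  ((Fintype.card ι : ℝ≥0∞) ^ a)⁻¹ * ∑ f : Fin a → ι, Φ (Finset.univ.image f)

/-- Concatenating tuples unites their sets of entries. Adding `k` fresh uniform indices is thus the
same as lengthening the tuple. -/
lemma tupleAvg_append (a k : ℕ) (Φ : Finset ι → ℝ≥0∞) :
    tupleAvg (a + k) Φ = tupleAvg a fun R => tupleAvg k fun S => Φ (R ∪ S) := by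
  have himg : ∀ (f : Fin a → ι) (g : Fin k → ι), Finset.univ.image (Fin.append f g) =
      Finset.univ.image f ∪ Finset.univ.image g := by
    intro f g
    ext i
    simp only [Finset.mem_image, Finset.mem_univ, true_and, Finset.mem_union]
    constructor
    · rintro ⟨l, rfl⟩
      induction l using Fin.addCases with
      | left l => exact Or.inl ⟨l, by simp⟩
      | right l => exact Or.inr ⟨l, by simp⟩
    · rintro (⟨l, rfl⟩ | ⟨l, rfl⟩)
      · exact ⟨Fin.castAdd k l, by simp⟩
      · exact ⟨Fin.natAdd a l, by simp⟩
  unfold tupleAvg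
  rw [← (Fin.appendEquiv a k).sum_comp, Fintype.sum_prod_type, pow_add,
    ENNReal.mul_inv (Or.inr (by finiteness)) (Or.inl (by finiteness)), mul_assoc, Finset.mul_sum]
  simp only [Fin.appendEquiv, Equiv.coe_fn_mk, himg]

lemma tupleAvg_le {a : ℕ} {Φ : Finset ι → ℝ≥0∞} {c : ℝ≥0∞} (h : ∀ R, Φ R ≤ c) :
    tupleAvg a Φ ≤ c := by
  calc tupleAvg a Φ ≤ ((Fintype.card ι : ℝ≥0∞) ^ a)⁻¹ * ∑ _f : Fin a → ι, c := by
        unfold tupleAvg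
        gcongr
        exact h _
    _ = (((Fintype.card ι : ℝ≥0∞) ^ a)⁻¹ * (Fintype.card ι : ℝ≥0∞) ^ a) * c := by
        simp [mul_assoc]
    _ ≤ 1 * c := by
        gcongr
        -- An inequality, since for empty `ι` and `a > 0` the product is `⊤ * 0 = 0`.
        exact ENNReal.inv_mul_le_one _
    _ = c := one_mul c

lemma tupleAvg_add (a : ℕ) (Φ Ψ : Finset ι → ℝ≥0∞) :
    tupleAvg a (fun R => Φ R + Ψ R) = tupleAvg a Φ + tupleAvg a Ψ := by
  simp only [tupleAvg, Finset.sum_add_distrib, mul_add]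

lemma tupleAvg_mul_left (a : ℕ) (c : ℝ≥0∞) (Φ : Finset ι → ℝ≥0∞) :
    tupleAvg a (fun R => c * Φ R) = c * tupleAvg a Φ := by
  simp only [tupleAvg, ← Finset.mul_sum]
  ring

lemma tupleAvg_sum {κ : Type*} (a : ℕ) (s : Finset κ) (Φ : κ → Finset ι → ℝ≥0∞) :
    tupleAvg a (fun R => ∑ i ∈ s, Φ i R) = ∑ i ∈ s, tupleAvg a (Φ i) := by
  simp only [tupleAvg, Finset.mul_sum]
  exact Finset.sum_comm

lemma tupleAvg_comm {κ : Type*} [Fintype κ] [DecidableEq κ] (a b : ℕ)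
    (Φ : Finset ι → Finset κ → ℝ≥0∞) :
    (tupleAvg a fun R => tupleAvg b fun C => Φ R C) =
      tupleAvg b fun C => tupleAvg a fun R => Φ R C := by
  simp only [tupleAvg, Finset.mul_sum]
  rw [Finset.sum_comm]
  simp only [mul_left_comm]

/-- Each set of size `k` is the image of at least `k!` tuples, namely its enumerations; tuples with
repetitions only increase the right-hand side. -/
lemma sum_pow_card_mul_le (p : ℝ≥0∞) (Φ : Finset ι → ℝ≥0∞) :
    ∑ s : Finset ι, p ^ s.card * Φ s ≤
      ∑ k ∈ Finset.range (Fintype.card ι + 1),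
        (p * Fintype.card ι) ^ k / (k.factorial : ℝ≥0∞) * tupleAvg k Φ := by
  have hfib : ∀ (k : ℕ) (s : Finset ι), s ∈ Finset.powersetCard k Finset.univ →
      k.factorial ≤
        (Finset.univ.filter fun f : Fin k → ι => Finset.univ.image f = s).card := by
    intro k s hs
    have hc := (Finset.mem_powersetCard.1 hs).2
    have e0 : Fin k ≃ s := Fintype.equivOfCardEq (by simp [hc])
    have h1 : Fintype.card (Fin k ≃ s) = k.factorial := by
      rw [Fintype.card_equiv e0, Fintype.card_fin]
    rw [← h1, ← Finset.card_univ]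
    refine Finset.card_le_card_of_injOn (fun e l => (e l : ι)) ?_ ?_
    · intro e _
      simp only [Finset.coe_filter, Finset.mem_univ, true_and, Set.mem_ofPred_eq]
      ext i
      simp only [Finset.mem_image, Finset.mem_univ, true_and]
      constructor
      · rintro ⟨l, rfl⟩
        exact (e l).2
      · intro hi
        exact ⟨e.symm ⟨i, hi⟩, by simp⟩
    · intro e _ e' _ h
      ext l
      exact congrFun h l
  have hk : ∀ k : ℕ, (k.factorial : ℝ≥0∞) * ∑ s ∈ Finset.powersetCard k Finset.univ, Φ s ≤
      ∑ f : Fin k → ι, Φ (Finset.univ.image f) := by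
    intro k
    rw [← Finset.sum_fiberwise (s := Finset.univ) (g := fun f : Fin k → ι => Finset.univ.image f),
      Finset.mul_sum]
    calc ∑ s ∈ Finset.powersetCard k Finset.univ, (k.factorial : ℝ≥0∞) * Φ s
        ≤ ∑ s ∈ Finset.powersetCard k Finset.univ,
          ∑ f : Fin k → ι with Finset.univ.image f = s, Φ (Finset.univ.image f) := by
          refine Finset.sum_le_sum fun s hs => ?_
          rw [Finset.sum_congr rfl (g := fun _ => Φ s)
            fun f hf => by rw [(Finset.mem_filter.1 hf).2], Finset.sum_const, nsmul_eq_mul]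
          gcongr
          exact hfib k s hs
      _ ≤ _ := Finset.sum_le_sum_of_subset (Finset.subset_univ _)
  rw [← Finset.powerset_univ, Finset.sum_powerset, Finset.card_univ]
  refine Finset.sum_le_sum fun k _ => ?_
  rw [Finset.sum_congr rfl (g := fun s => p ^ k * Φ s)
    fun s hs => by rw [(Finset.mem_powersetCard.1 hs).2], ← Finset.mul_sum]
  rcases isEmpty_or_nonempty ι with hι | hι
  · rcases Nat.eq_zero_or_pos k with rfl | hk0
    · simp [tupleAvg]
    · have : Finset.powersetCard k (Finset.univ : Finset ι) = ∅ :=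
        Finset.powersetCard_eq_empty.2 (by simpa using hk0)
      rw [this, Finset.sum_empty, mul_zero]
      exact zero_le
  have hn : (Fintype.card ι : ℝ≥0∞) ^ k ≠ 0 := by simp [Fintype.card_ne_zero]
  have hn' : (Fintype.card ι : ℝ≥0∞) ^ k ≠ ⊤ := by finiteness
  calc p ^ k * ∑ s ∈ Finset.powersetCard k Finset.univ, Φ s
      ≤ p ^ k * ((k.factorial : ℝ≥0∞)⁻¹ * ∑ f : Fin k → ι, Φ (Finset.univ.image f)) := by
        gcongr
        rw [mul_comm, ← div_eq_mul_inv, ENNReal.le_div_iff_mul_le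
          (Or.inl (by simp [Nat.factorial_ne_zero])) (Or.inl (by finiteness)), mul_comm]
        exact hk k
    _ = p ^ k * ((Fintype.card ι : ℝ≥0∞) ^ k * ((Fintype.card ι : ℝ≥0∞) ^ k)⁻¹) *
        ((k.factorial : ℝ≥0∞)⁻¹ * ∑ f : Fin k → ι, Φ (Finset.univ.image f)) := by
        rw [ENNReal.mul_inv_cancel hn hn', mul_one]
    _ = _ := by
        unfold tupleAvg
        rw [mul_pow, div_eq_mul_inv]
        ring

lemma sum_Icc_shift (h : ℕ → ℝ≥0∞) (P : ℕ) :
    ∑ a ∈ Finset.Icc 1 P, h (a + 1) + h 1 = ∑ a ∈ Finset.Icc 1 P, h a + h (P + 1) := by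
  induction P with
  | zero => simp
  | succ P ih =>
    rw [Finset.sum_Icc_succ_top (by omega), Finset.sum_Icc_succ_top (by omega), ← ih]
    ring

/-- Each unit shift exchanges one boundary term, worth at most `c`. -/
lemma sum_Icc_shift_le {h : ℕ → ℝ≥0∞} {c : ℝ≥0∞} (hc : ∀ a, h a ≤ c) (P k : ℕ) :
    ∑ a ∈ Finset.Icc 1 P, h (a + k) ≤ ∑ a ∈ Finset.Icc 1 P, h a + k * c := by
  induction k with
  | zero => simp
  | succ k ih =>
    calc ∑ a ∈ Finset.Icc 1 P, h (a + (k + 1))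
        ≤ ∑ a ∈ Finset.Icc 1 P, h (a + 1 + k) + h (1 + k) := by
          simp only [add_assoc, add_comm 1 k]
          exact le_self_add
      _ = ∑ a ∈ Finset.Icc 1 P, h (a + k) + h (P + 1 + k) :=
          sum_Icc_shift (fun a => h (a + k)) P
      _ ≤ (∑ a ∈ Finset.Icc 1 P, h a + k * c) + c := add_le_add ih (hc _)
      _ = _ := by push_cast; ring

lemma le_sum_Icc_shift {h : ℕ → ℝ≥0∞} {c : ℝ≥0∞} (hc : ∀ a, h a ≤ c) (P k : ℕ) :
    ∑ a ∈ Finset.Icc 1 P, h a ≤ ∑ a ∈ Finset.Icc 1 P, h (a + k) + k * c := by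
  induction k with
  | zero => simp
  | succ k ih =>
    calc ∑ a ∈ Finset.Icc 1 P, h a
        ≤ ∑ a ∈ Finset.Icc 1 P, h (a + k) + k * c := ih
      _ ≤ (∑ a ∈ Finset.Icc 1 P, h (a + 1 + k) + h (1 + k)) + k * c := by
          gcongr
          refine le_self_add.trans (sum_Icc_shift (fun a => h (a + k)) P).ge
      _ ≤ (∑ a ∈ Finset.Icc 1 P, h (a + 1 + k) + c) + k * c := by
          gcongr
          exact hc _
      _ = _ := by
          simp only [add_assoc, add_comm 1 k]
          push_cast
          ring

/-- The number of elements gained by `D` when `S` moves from the second to the first argument. -/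
noncomputable def gap {κ : Type*} [DecidableEq κ] (D : Finset κ → Finset κ → Finset κ)
    (R C S : Finset κ) : ℝ≥0∞ :=
  ((D (R ∪ S) C \ D R (C ∪ S)).card : ℝ≥0∞)

/-- The two sets are nested, so the gap is a difference of cardinalities, put additively to avoid
truncated subtraction. -/
lemma gap_add {κ : Type*} [DecidableEq κ] {D : Finset κ → Finset κ → Finset κ}
    (hD : ∀ {R R' C C'}, R ⊆ R' → C' ⊆ C → D R C ⊆ D R' C') (R C S : Finset κ) :
    gap D R C S + ((D R (C ∪ S)).card : ℝ≥0∞) = ((D (R ∪ S) C).card : ℝ≥0∞) := by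
  rw [gap, ← Nat.cast_add, Finset.card_sdiff_add_card_eq_card]
  exact hD Finset.subset_union_left Finset.subset_union_left

/-- The average of the gap over tuples whose lengths are uniform in `{1, …, P}²` telescopes. -/
lemma sum_tupleAvg_gap_le {D : Finset ι → Finset ι → Finset ι}
    (hD : ∀ {R R' C C'}, R ⊆ R' → C' ⊆ C → D R C ⊆ D R' C') (P k : ℕ) :
    ∑ a ∈ Finset.Icc 1 P, ∑ b ∈ Finset.Icc 1 P,
      (tupleAvg a fun R => tupleAvg b fun C => tupleAvg k fun S => gap D R C S) ≤
      2 * k * P * Fintype.card ι := by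
  set N : ℝ≥0∞ := (Fintype.card ι : ℝ≥0∞)
  let H : ℕ → ℕ → ℝ≥0∞ := fun a b =>
    tupleAvg a fun R => tupleAvg b fun C => ((D R C).card : ℝ≥0∞)
  have hH : ∀ a b, H a b ≤ N := fun a b => tupleAvg_le fun R => tupleAvg_le fun C => by
    exact Nat.cast_le.2 (Finset.card_le_univ _)
  -- The tuple `S` lengthens the first tuple in one term and the second tuple in the other.
  have hgap : ∀ a b,
      (tupleAvg a fun R => tupleAvg b fun C => tupleAvg k fun S => gap D R C S) +
        H a (b + k) = H (a + k) b := by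
    intro a b
    simp only [H, tupleAvg_append]
    rw [← tupleAvg_add]
    congr 1
    funext R
    rw [← tupleAvg_add, tupleAvg_comm k b]
    congr 1
    funext C
    rw [← tupleAvg_add]
    simp only [gap_add hD]
  set G := ∑ a ∈ Finset.Icc 1 P, ∑ b ∈ Finset.Icc 1 P,
      (tupleAvg a fun R => tupleAvg b fun C => tupleAvg k fun S => gap D R C S)
  have hfin : ∑ a ∈ Finset.Icc 1 P, ∑ b ∈ Finset.Icc 1 P, H a (b + k) ≠ ⊤ :=
    ENNReal.sum_ne_top.2 fun a _ => ENNReal.sum_ne_top.2 fun b _ =>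
      ((hH _ _).trans_lt (ENNReal.natCast_lt_top _)).ne
  -- Both double sums are compared with the unshifted sum of `H`; each shift costs `k * N` in each
  -- of `P` lines, whence `2 * k * P * N`.
  refine (ENNReal.add_le_add_iff_right hfin).1 ?_
  calc G + ∑ a ∈ Finset.Icc 1 P, ∑ b ∈ Finset.Icc 1 P, H a (b + k)
      = ∑ b ∈ Finset.Icc 1 P, ∑ a ∈ Finset.Icc 1 P, H (a + k) b := by
        rw [Finset.sum_comm (s := Finset.Icc 1 P) (f := fun b a => H (a + k) b),
          ← Finset.sum_add_distrib]
        refine Finset.sum_congr rfl fun a _ => ?_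
        rw [← Finset.sum_add_distrib]
        exact Finset.sum_congr rfl fun b _ => hgap a b
    _ ≤ ∑ b ∈ Finset.Icc 1 P, (∑ a ∈ Finset.Icc 1 P, H a b + k * N) :=
        Finset.sum_le_sum fun b _ => sum_Icc_shift_le (h := fun a => H a b) (fun a => hH a b) P k
    _ = ∑ a ∈ Finset.Icc 1 P, ∑ b ∈ Finset.Icc 1 P, H a b + P * (k * N) := by
        rw [Finset.sum_add_distrib, Finset.sum_comm]
        simp
    _ ≤ ∑ a ∈ Finset.Icc 1 P, (∑ b ∈ Finset.Icc 1 P, H a (b + k) + k * N) + P * (k * N) := by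
        gcongr with a
        exact le_sum_Icc_shift (hH a) P k
    _ = _ := by
        rw [Finset.sum_add_distrib]
        simp only [Finset.sum_const, Nat.card_Icc, add_tsub_cancel_right, nsmul_eq_mul]
        ring

/-- The version for the transpose, where the two perturbations exchange roles. -/
lemma sum_tupleAvg_gap_swap_le {D : Finset ι → Finset ι → Finset ι}
    (hD : ∀ {R R' C C'}, R ⊆ R' → C' ⊆ C → D R C ⊆ D R' C') (P k : ℕ) :
    ∑ a ∈ Finset.Icc 1 P, ∑ b ∈ Finset.Icc 1 P,
      (tupleAvg a fun R => tupleAvg b fun C => tupleAvg k fun S => gap D C R S) ≤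
      2 * k * P * Fintype.card ι := by
  rw [Finset.sum_comm]
  refine le_trans (le_of_eq ?_) (sum_tupleAvg_gap_le hD P k)
  exact Finset.sum_congr rfl fun b _ => Finset.sum_congr rfl fun a _ => tupleAvg_comm a b _

/-- Cancelling `k` against `k!` leaves `d` times a partial sum of the exponential series. -/
lemma sum_pow_div_factorial_mul_le {d : ℝ} (hd : 0 ≤ d) (n : ℕ) :
    ∑ k ∈ Finset.range (n + 1), ENNReal.ofReal d ^ k / (k.factorial : ℝ≥0∞) * k ≤
      ENNReal.ofReal (d * Real.exp d) := by
  have h : ∀ k : ℕ, ENNReal.ofReal d ^ k / (k.factorial : ℝ≥0∞) * k =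
      ENNReal.ofReal (d ^ k / k.factorial * k) := by
    intro k
    rw [ENNReal.ofReal_mul (by positivity), ENNReal.ofReal_div_of_pos (by positivity),
      ENNReal.ofReal_pow hd, ENNReal.ofReal_natCast, ENNReal.ofReal_natCast]
  simp_rw [h]
  rw [← ENNReal.ofReal_sum_of_nonneg fun k _ => by positivity]
  refine ENNReal.ofReal_le_ofReal ?_
  rw [Finset.sum_range_succ']
  calc _ = d * ∑ k ∈ Finset.range n, d ^ k / (k.factorial : ℝ) := by
        rw [Finset.mul_sum]
        simp only [Nat.cast_zero, mul_zero, add_zero]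
        refine Finset.sum_congr rfl fun k _ => ?_
        rw [Nat.factorial_succ, Nat.cast_mul]
        field_simp
        ring
    _ ≤ _ := by
        gcongr
        exact Real.sum_le_exp_of_nonneg hd n

end TupleAverage

/-! ### The law of the coupled perturbation positions. -/

section HitTimes

lemma lastHit_lt {n : ℕ} (hn : 0 < n) (u : HitArray) (k : ℕ) : lastHit u k n < n := by
  rw [lastHit, Finset.sup_lt_iff (by simpa using hn)]
  intro l hl
  simpa using (Finset.mem_filter.1 hl).1

lemma lastHit_succ {n : ℕ} {u : HitArray} {k : ℕ} (h : (u (k, n) : ℕ) ≠ n) :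
    lastHit u k (n + 1) = lastHit u k n := by
  rw [lastHit, Finset.range_add_one, Finset.filter_insert, if_neg h, lastHit]

lemma lastHit_eq_iff {n l : ℕ} (hl : l < n) (u : HitArray) (k : ℕ) :
    lastHit u k n = l ↔ (u (k, l) : ℕ) = l ∧ ∀ m < n, l < m → (u (k, m) : ℕ) ≠ m := by
  have hmem : lastHit u k n ∈ (Finset.range n).filter fun l => (u (k, l) : ℕ) = l := by
    have h0 : ((Finset.range n).filter fun l => (u (k, l) : ℕ) = l).Nonempty :=
      ⟨0, Finset.mem_filter.2 ⟨Finset.mem_range.2 (by omega), by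
        have := (u (k, 0)).2
        dsimp only at this
        omega⟩⟩
    obtain ⟨b, hb, h⟩ := Finset.exists_mem_eq_sup _ h0 id
    rw [lastHit, h]
    exact hb
  constructor
  · rintro rfl
    refine ⟨(Finset.mem_filter.1 hmem).2, fun m hm hlt heq => ?_⟩
    have : m ≤ lastHit u k n :=
      Finset.le_sup (f := id) (Finset.mem_filter.2 ⟨Finset.mem_range.2 hm, heq⟩)
    omega
  · rintro ⟨h1, h2⟩
    have hle : l ≤ lastHit u k n :=
      Finset.le_sup (f := id) (Finset.mem_filter.2 ⟨Finset.mem_range.2 hl, h1⟩)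
    by_contra hne
    have := Finset.mem_filter.1 hmem
    exact h2 _ (Finset.mem_range.1 this.1) (by omega) this.2

lemma uniformOn_univ_hit (m : ℕ) :
    uniformOn (Set.univ : Set (Fin (m + 1))) {x | (x : ℕ) = m} = ((m : ℝ≥0∞) + 1)⁻¹ := by
  have : {x : Fin (m + 1) | (x : ℕ) = m} = {Fin.last m} := by
    ext x
    simp [Fin.ext_iff]
  rw [this, uniformOn_univ, Measure.count_singleton]
  simp

lemma uniformOn_univ_not_hit (m : ℕ) :
    uniformOn (Set.univ : Set (Fin (m + 1))) {x | (x : ℕ) ≠ m} = m * ((m : ℝ≥0∞) + 1)⁻¹ := by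
  have : {x : Fin (m + 1) | (x : ℕ) ≠ m} = ((Finset.univ.erase (Fin.last m) : Finset _) : Set _) := by
    ext x
    simp [Fin.ext_iff]
  rw [this, uniformOn_univ, Measure.count_apply_finset]
  simp [div_eq_mul_inv]

/-- The condition on the entry `u (k, m)` imposed by `lastHit u k n = l`. -/
def hitCond (l m : ℕ) : Set (Fin (m + 1)) :=
  if m < l then Set.univ else if m = l then {x | (x : ℕ) = m} else {x | (x : ℕ) ≠ m}

/-- The product telescopes: `1/(l+1)` from the hit at `l`, then `m/(m+1)` for each later miss. -/
lemma prod_hitCond (l : ℕ) {n : ℕ} (hl : l < n) :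
    ∏ m ∈ Finset.range n, uniformOn (Set.univ : Set (Fin (m + 1))) (hitCond l m) =
      (n : ℝ≥0∞)⁻¹ := by
  induction n, hl using Nat.le_induction with
  | base =>
    rw [Finset.prod_range_succ, Finset.prod_eq_one, one_mul, hitCond, if_neg (lt_irrefl _),
      if_pos rfl, uniformOn_univ_hit, Nat.cast_succ]
    intro m hm
    rw [hitCond, if_pos (Finset.mem_range.1 hm), measure_univ]
  | succ n hn ih =>
    rw [Finset.prod_range_succ, ih, hitCond, if_neg (by omega), if_neg (by omega),
      uniformOn_univ_not_hit, ← mul_assoc,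
      ENNReal.inv_mul_cancel (by simp; omega) (by finiteness), one_mul, Nat.cast_succ]

/-- The event is a finite-dimensional box, whose probability the product measure gives as a product.
-/
lemma lastHit_preimage {θ n : ℕ} (l : Fin θ → Fin n) :
    {u : HitArray | ∀ k : Fin θ, lastHit u k n = l k} =
      ((Finset.range θ ×ˢ Finset.range n : Finset (ℕ × ℕ)) : Set (ℕ × ℕ)).pi fun i =>
        if h : i.1 < θ then hitCond (l ⟨i.1, h⟩) i.2 else Set.univ := by
  ext u
  simp only [Set.mem_ofPred_eq, Set.mem_pi, Finset.coe_product, Set.mem_prod, Finset.coe_range,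
    Set.mem_Iio]
  constructor
  · rintro h ⟨k, m⟩ ⟨hk, hm⟩
    obtain ⟨h1, h2⟩ := (lastHit_eq_iff (l ⟨k, hk⟩).2 u k).1 (h ⟨k, hk⟩)
    dsimp only at hk hm ⊢
    rw [dif_pos hk, hitCond]
    split_ifs with h3 h4
    · trivial
    · subst h4
      exact h1
    · exact h2 m hm (by omega)
  · intro h k
    rw [lastHit_eq_iff (l k).2]
    constructor
    · have := h (k, l k) ⟨k.2, (l k).2⟩
      dsimp only at this
      rw [dif_pos k.2, hitCond, if_neg (lt_irrefl _), if_pos rfl] at this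
      exact this
    · intro m hm hlt
      have := h (k, m) ⟨k.2, hm⟩
      dsimp only at this
      rw [dif_pos k.2, hitCond, if_neg (by simpa using hlt.le), if_neg (by simpa using hlt.ne')]
        at this
      exact this

instance : IsProbabilityMeasure hitLaw := by
  unfold hitLaw
  infer_instance

lemma hitLaw_lastHit_eq {θ n : ℕ} (l : Fin θ → Fin n) :
    hitLaw {u | ∀ k : Fin θ, lastHit u k n = l k} = ((n : ℝ≥0∞) ^ θ)⁻¹ := by
  rw [lastHit_preimage, hitLaw, Measure.infinitePi_pi _ fun _ _ => .of_discrete,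
    Finset.prod_product, Finset.prod_range fun k => ∏ m ∈ Finset.range n, _]
  simp only [Fin.is_lt, dif_pos, Fin.eta]
  rw [Finset.prod_congr rfl fun k _ => prod_hitCond (l k) (l k).2, Finset.prod_const,
    Finset.card_univ, Fintype.card_fin, ENNReal.inv_pow]

/-- The positions hit by the perturbation are independent and uniform. -/
lemma lintegral_hitSet {n : ℕ} (hn : 0 < n) (θ : ℕ) (Φ : Finset (Fin n) → ℝ≥0∞) :
    ∫⁻ u, Φ (hitSet u θ n) ∂hitLaw = tupleAvg θ Φ := by
  let X : HitArray → Fin θ → Fin n := fun u k => ⟨lastHit u k n, lastHit_lt hn u k⟩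
  have hpre : ∀ l, X ⁻¹' {l} = {u | ∀ k : Fin θ, lastHit u k n = l k} := by
    intro l
    ext u
    simp [X, funext_iff, Fin.ext_iff]
  have hX : Measurable X := by
    refine measurable_to_countable' fun l => ?_
    rw [hpre, lastHit_preimage]
    exact MeasurableSet.pi (Finset.countable_toSet _) fun _ _ => .of_discrete
  have himg : ∀ u, hitSet u θ n = Finset.univ.image (X u) := by
    intro u
    ext j
    simp [mem_hitSet, X, Fin.ext_iff, eq_comm]
  simp_rw [himg]
  rw [← lintegral_map (f := fun l : Fin θ → Fin n => Φ (Finset.univ.image l)) .of_discrete hX,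
    lintegral_fintype, tupleAvg, Finset.mul_sum]
  refine Finset.sum_congr rfl fun l _ => ?_
  rw [Measure.map_apply hX .of_discrete, hpre, hitLaw_lastHit_eq, mul_comm, Fintype.card_fin]

lemma measurable_hit (k n : ℕ) : MeasurableSet {u : HitArray | (u (k, n) : ℕ) = n} :=
  measurable_pi_apply (X := fun i : ℕ × ℕ => Fin (i.2 + 1)) (k, n)
    (MeasurableSet.of_discrete (s := {x : Fin (n + 1) | (x : ℕ) = n}))

lemma hitLaw_exists_hit_le (θ n : ℕ) :
    hitLaw {u | ∃ k < θ, (u (k, n) : ℕ) = n} ≤ θ * ((n : ℝ≥0∞) + 1)⁻¹ := by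
  have h1 : ∀ k, hitLaw {u | (u (k, n) : ℕ) = n} = ((n : ℝ≥0∞) + 1)⁻¹ := by
    intro k
    rw [← uniformOn_univ_hit n, ← Measure.infinitePi_map_eval
      (fun i : ℕ × ℕ => uniformOn (Set.univ : Set (Fin (i.2 + 1)))) (k, n),
      Measure.map_apply (measurable_pi_apply _) .of_discrete]
    rfl
  have h2 : {u : HitArray | ∃ k < θ, (u (k, n) : ℕ) = n} =
      ⋃ k ∈ Finset.range θ, {u : HitArray | (u (k, n) : ℕ) = n} := by
    ext u
    simp
  rw [h2]
  refine (measure_biUnion_finset_le _ _).trans (le_of_eq ?_)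
  simp [h1]

end HitTimes

/-! ### Independence of the new column from the old matrix. -/

section EdgeIndependence

variable {F : Type*} [Field F] {N n : ℕ}

/-- The indices `i` of the non-zero entries of the last column of `matT J q τ p (n + 1) hN`. -/
noncomputable def newSupport (q : ℕ × ℕ → unitInterval) (τ : Equiv.Perm (Fin N)) (p : ℝ) (hN : n + 1 ≤ N) :
    Finset (Fin n) :=
  {i | (q (τ (Fin.castLE hN i.castSucc), τ (Fin.castLE hN (Fin.last n))) : ℝ) < p}

lemma mem_newSupport {q : ℕ × ℕ → unitInterval} {τ : Equiv.Perm (Fin N)} {p : ℝ}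
    {hN : n + 1 ≤ N} {i : Fin n} : i ∈ newSupport q τ p hN ↔
      (q (τ (Fin.castLE hN i.castSucc), τ (Fin.castLE hN (Fin.last n))) : ℝ) < p := by
  simp [newSupport]

/-- `matT` as a function of the edge indicators. -/
noncomputable def edgeMatrix (J : Template F N) (τ : Equiv.Perm (Fin N)) (hn : n ≤ N)
    (e : Fin n → Fin n → Prop) : Matrix (Fin n) (Fin n) F :=
  open Classical in
  Matrix.of fun i j =>
    let a := τ (Fin.castLE hn i)
    let b := τ (Fin.castLE hn j)
    if i < j then (if e i j then J.1 a b else 0)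
    else if j < i then (if e j i then J.1 b a else 0)
    else 0

lemma matT_eq_edgeMatrix (J : Template F N) (q : ℕ × ℕ → unitInterval) (τ : Equiv.Perm (Fin N))
    (p : ℝ) (hn : n ≤ N) : matT J q τ p n hn = edgeMatrix J τ hn fun i j =>
      (q (τ (Fin.castLE hn i), τ (Fin.castLE hn j)) : ℝ) < p := by
  ext i j
  simp only [matT, edgeMatrix, Matrix.of_apply]

lemma measurable_coord_lt (i : ℕ × ℕ) (p : ℝ) :
    Measurable fun q : ℕ × ℕ → unitInterval => (q i : ℝ) < p :=
  measurableSet_setOfPred.1 (measurableSet_lt (by fun_prop) measurable_const)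

/-- Only finitely many edge indicators matter, and every function on their discrete space is
measurable. -/
lemma measurable_comp_matT (J : Template F N) (τ : Equiv.Perm (Fin N)) (p : ℝ) (hN : n + 1 ≤ N)
    (g : Matrix (Fin n) (Fin n) F → Finset (Fin n) → ℝ≥0∞) :
    Measurable fun q => g (matT J q τ p n (n.le_succ.trans hN)) (newSupport q τ p hN) := by
  classical
  let e : (ℕ × ℕ → unitInterval) → (Fin n → Fin n → Prop) × (Fin n → Prop) := fun q =>
    (fun i j => (q (τ (Fin.castLE (n.le_succ.trans hN) i),
      τ (Fin.castLE (n.le_succ.trans hN) j)) : ℝ) < p,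
    fun i => (q (τ (Fin.castLE hN i.castSucc), τ (Fin.castLE hN (Fin.last n))) : ℝ) < p)
  have he : Measurable e :=
    (measurable_pi_lambda _ fun i => measurable_pi_lambda _ fun j =>
      measurable_coord_lt _ _).prodMk (measurable_pi_lambda _ fun i => measurable_coord_lt _ _)
  let ψ : (Fin n → Fin n → Prop) × (Fin n → Prop) → ℝ≥0∞ := fun e =>
    g (edgeMatrix J τ (n.le_succ.trans hN) e.1) (Finset.univ.filter e.2)
  have : (fun q => g (matT J q τ p n (n.le_succ.trans hN)) (newSupport q τ p hN)) = ψ ∘ e := by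
    ext q
    simp only [matT_eq_edgeMatrix, Function.comp_apply, ψ, e, newSupport]
  rw [this]
  exact (Measurable.of_discrete (f := ψ)).comp he

lemma volume_unitInterval_lt_le (p : ℝ) :
    (volume : Measure unitInterval) {x | (x : ℝ) < p} ≤ ENNReal.ofReal p := by
  rw [unitInterval.volume_apply]
  calc volume (Subtype.val '' {x : unitInterval | (x : ℝ) < p}) ≤ volume (Set.Ico 0 p) := by
        refine measure_mono ?_
        rintro _ ⟨x, hx, rfl⟩
        exact ⟨x.2.1, hx⟩
    _ = ENNReal.ofReal p := by simp

/-- The new column is independent of the old matrix, and it covers `s` with probability at most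
`p ^ |s|`. -/
lemma lintegral_newSupport_le (J : Template F N) (τ : Equiv.Perm (Fin N)) (p : ℝ)
    (hN : n + 1 ≤ N) (s : Finset (Fin n)) (g : Matrix (Fin n) (Fin n) F → ℝ≥0∞) :
    ∫⁻ q, (if s ⊆ newSupport q τ p hN then g (matT J q τ p n (n.le_succ.trans hN)) else 0)
        ∂(Measure.infinitePi fun _ : ℕ × ℕ => (volume : Measure unitInterval)) ≤
      ENNReal.ofReal p ^ s.card * ∫⁻ q, g (matT J q τ p n (n.le_succ.trans hN))
        ∂(Measure.infinitePi fun _ : ℕ × ℕ => (volume : Measure unitInterval)) := by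
  classical
  set μ := Measure.infinitePi fun _ : ℕ × ℕ => (volume : Measure unitInterval)
  let cell : Fin n → ℕ × ℕ := fun i =>
    (τ (Fin.castLE hN i.castSucc), τ (Fin.castLE hN (Fin.last n)))
  let old : Fin n × Fin n → ℕ × ℕ := fun i =>
    (τ (Fin.castLE (n.le_succ.trans hN) i.1), τ (Fin.castLE (n.le_succ.trans hN) i.2))
  have hcell : Function.Injective cell := by
    intro i j h
    have h1 := τ.injective (Fin.ext (Prod.ext_iff.1 h).1)
    exact Fin.castSucc_injective _ (Fin.castLE_injective hN h1)
  -- New cells have second coordinate `τ` of the last label, old cells `τ` of an earlier one.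
  have hdisj : Disjoint (s.image cell) (Finset.univ.image old) := by
    rw [Finset.disjoint_left]
    intro x hx hx'
    obtain ⟨i, _, rfl⟩ := Finset.mem_image.1 hx
    obtain ⟨j, _, hj⟩ := Finset.mem_image.1 hx'
    have := (Prod.ext_iff.1 hj).2
    simp only [old, cell, Fin.val_inj, EmbeddingLike.apply_eq_iff_eq, Fin.ext_iff,
      Fin.val_castLE, Fin.val_last] at this
    exact j.2.2.ne this
  have hind : iIndepFun (fun (i : ℕ × ℕ) (q : ℕ × ℕ → unitInterval) => q i) μ :=
    iIndepFun_infinitePi (X := fun _ x => x) fun _ => measurable_id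
  have hind2 := hind.indepFun_finset (s.image cell) (Finset.univ.image old) hdisj
    fun i => measurable_pi_apply i
  let E : Set (s.image cell → unitInterval) := {w | ∀ x, (w x : ℝ) < p}
  have hE : MeasurableSet E := by
    have : E = ⋂ x, {w | (w x : ℝ) < p} := by
      ext w
      simp [E]
    rw [this]
    exact MeasurableSet.iInter fun x => measurableSet_lt (by fun_prop) measurable_const
  let φ : (s.image cell → unitInterval) → ℝ≥0∞ := E.indicator 1
  have hφ : Measurable φ := measurable_one.indicator hE
  let e : (Finset.univ.image old → unitInterval) → Fin n → Fin n → Prop := fun w i j =>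
    (w ⟨old (i, j), Finset.mem_image_of_mem _ (Finset.mem_univ _)⟩ : ℝ) < p
  have he : Measurable e := measurable_pi_lambda _ fun i => measurable_pi_lambda _ fun j =>
    measurableSet_setOfPred.1 (measurableSet_lt (by fun_prop) measurable_const)
  let ψ : (Finset.univ.image old → unitInterval) → ℝ≥0∞ := fun w =>
    g (edgeMatrix J τ (n.le_succ.trans hN) (e w))
  have hψ : Measurable ψ := (Measurable.of_discrete
    (f := fun e => g (edgeMatrix J τ (n.le_succ.trans hN) e))).comp he
  have hres1 : Measurable fun (q : ℕ × ℕ → unitInterval) (i : s.image cell) => q i := by fun_prop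
  have hres2 : Measurable fun (q : ℕ × ℕ → unitInterval) (i : Finset.univ.image old) => q i := by
    fun_prop
  have hmul := lintegral_mul_eq_lintegral_mul_lintegral_of_indepFun (hφ.comp hres1)
    (hψ.comp hres2) (hind2.comp hφ hψ)
  have hsub : ∀ q : ℕ × ℕ → unitInterval,
      (fun i : s.image cell => q i) ∈ E ↔ s ⊆ newSupport q τ p hN := by
    intro q
    simp only [E, Set.mem_ofPred_eq, Subtype.forall, Finset.mem_image, forall_exists_index, and_imp,
      forall_apply_eq_imp_iff₂, Finset.subset_iff, mem_newSupport, cell]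
  have hleft : ∀ q : ℕ × ℕ → unitInterval,
      (if s ⊆ newSupport q τ p hN then g (matT J q τ p n (n.le_succ.trans hN)) else 0) =
      ((φ ∘ fun (q : ℕ × ℕ → unitInterval) (i : s.image cell) => q i) *
        (ψ ∘ fun (q : ℕ × ℕ → unitInterval) (i : Finset.univ.image old) => q i)) q := by
    intro q
    simp only [Pi.mul_apply, Function.comp_apply, φ, Set.indicator_apply, hsub, ψ, e, old,
      matT_eq_edgeMatrix]
    split_ifs <;> simp
  have hφint : ∫⁻ q, (φ ∘ fun (q : ℕ × ℕ → unitInterval) (i : s.image cell) => q i) q ∂μ ≤ ENNReal.ofReal p ^ s.card := by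
    have h1 : (φ ∘ fun (q : ℕ × ℕ → unitInterval) (i : s.image cell) => q i) =
        ((s.image cell : Set (ℕ × ℕ)).pi fun _ => {x : unitInterval | (x : ℝ) < p}).indicator 1 := by
      ext q
      simp only [Function.comp_apply, φ, Set.indicator_apply, E, Set.mem_ofPred_eq, Set.mem_pi,
        Subtype.forall, Finset.mem_coe]
      rfl
    have h2 : MeasurableSet {x : unitInterval | (x : ℝ) < p} :=
      measurableSet_lt (by fun_prop) measurable_const
    rw [h1, lintegral_indicator_one (MeasurableSet.pi (Finset.countable_toSet _) fun _ _ => h2),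
      Measure.infinitePi_pi _ fun _ _ => h2, Finset.prod_const,
      Finset.card_image_of_injective _ hcell]
    gcongr
    exact volume_unitInterval_lt_le p
  simp_rw [hleft]
  rw [hmul]
  refine mul_le_mul' hφint (lintegral_congr fun q => ?_).le
  simp only [Function.comp_apply, ψ, e, old, matT_eq_edgeMatrix]

end EdgeIndependence

/-! ### Integration over the joint law. -/

section LawIntegral

lemma lintegral_uniformOn_square (P : ℕ) (f : ℕ × ℕ → ℝ≥0∞) :
    ∫⁻ θ, f θ ∂(uniformOn (Set.Icc 1 P ×ˢ Set.Icc 1 P : Set (ℕ × ℕ))) =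
      ((P : ℝ≥0∞) ^ 2)⁻¹ * ∑ a ∈ Finset.Icc 1 P, ∑ b ∈ Finset.Icc 1 P, f (a, b) := by
  have hs : (Set.Icc 1 P ×ˢ Set.Icc 1 P : Set (ℕ × ℕ)) =
      ((Finset.Icc 1 P ×ˢ Finset.Icc 1 P : Finset (ℕ × ℕ)) : Set (ℕ × ℕ)) := by simp
  rw [hs, uniformOn, ProbabilityTheory.cond, lintegral_smul_measure, lintegral_finset,
    Measure.count_apply_finset, smul_eq_mul]
  simp [Finset.sum_product, sq]

/-- This half of Tonelli's theorem needs no measurability of `f`, and upper bounds suffice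
throughout. -/
lemma lintegral_law_le (N P : ℕ) (f : Outcome N → ℝ≥0∞) :
    ∫⁻ ω, f ω ∂(law N P) ≤
      ∫⁻ q, ∫⁻ τ, ((P : ℝ≥0∞) ^ 2)⁻¹ * ∑ a ∈ Finset.Icc 1 P, ∑ b ∈ Finset.Icc 1 P,
        ∫⁻ ur, ∫⁻ uc, f (q, τ, (a, b), ur, uc) ∂hitLaw ∂hitLaw
        ∂(uniformOn (Set.univ : Set (Equiv.Perm (Fin N))))
        ∂(Measure.infinitePi fun _ : ℕ × ℕ => (volume : Measure unitInterval)) := by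
  unfold law
  refine (lintegral_prod_le _).trans (lintegral_mono fun q => ?_)
  refine (lintegral_prod_le _).trans (lintegral_mono fun τ => ?_)
  refine (lintegral_prod_le _).trans ?_
  rw [lintegral_uniformOn_square]
  gcongr with a _ b
  exact lintegral_prod_le _

lemma lintegral_law_le_of_forall {N P : ℕ} {f : Outcome N → ℝ≥0∞} {c : ℝ≥0∞}
    (h : ∀ q τ, ∀ a ≤ P, ∀ b ≤ P, ∫⁻ ur, ∫⁻ uc, f (q, τ, (a, b), ur, uc) ∂hitLaw ∂hitLaw ≤ c) :
    ∫⁻ ω, f ω ∂(law N P) ≤ c := by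
  refine (lintegral_law_le N P f).trans ?_
  calc _ ≤ ∫⁻ _q, ∫⁻ _τ, c ∂(uniformOn (Set.univ : Set (Equiv.Perm (Fin N))))
        ∂(Measure.infinitePi fun _ : ℕ × ℕ => (volume : Measure unitInterval)) := by
        refine lintegral_mono fun q => lintegral_mono fun τ => ?_
        calc _ ≤ ((P : ℝ≥0∞) ^ 2)⁻¹ * ∑ a ∈ Finset.Icc 1 P, ∑ b ∈ Finset.Icc 1 P, c := by
              gcongr with a ha b hb
              exact h q τ a (Finset.mem_Icc.1 ha).2 b (Finset.mem_Icc.1 hb).2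
          _ = (((P : ℝ≥0∞) ^ 2)⁻¹ * (P : ℝ≥0∞) ^ 2) * c := by
              simp only [Finset.sum_const, Nat.card_Icc, add_tsub_cancel_right, nsmul_eq_mul]
              ring
          _ ≤ 1 * c := by
              gcongr
              exact ENNReal.inv_mul_le_one _
          _ = c := one_mul c
    _ = c := by simp

/-- The event that one of the first `θ` hitting times changes between `n` and `n + 1`. -/
def rowChange (N n : ℕ) : Set (Outcome N) :=
  {ω | ∃ k < ω.2.2.1.1, (ω.2.2.2.1 (k, n) : ℕ) = n}

def colChange (N n : ℕ) : Set (Outcome N) :=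
  {ω | ∃ k < ω.2.2.1.2, (ω.2.2.2.2 (k, n) : ℕ) = n}

lemma measurableSet_rowChange (N n : ℕ) : MeasurableSet (rowChange N n) := by
  have : rowChange N n = ⋃ k : ℕ, {ω : Outcome N | k < ω.2.2.1.1} ∩
      (fun ω : Outcome N => ω.2.2.2.1) ⁻¹' {u | (u (k, n) : ℕ) = n} := by
    ext ω
    simp [rowChange]
  rw [this]
  refine MeasurableSet.iUnion fun k => MeasurableSet.inter ?_ ?_
  · exact measurableSet_lt measurable_const (by fun_prop)
  · exact (by fun_prop : Measurable fun ω : Outcome N => ω.2.2.2.1) (measurable_hit k n)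

lemma measurableSet_colChange (N n : ℕ) : MeasurableSet (colChange N n) := by
  have : colChange N n = ⋃ k : ℕ, {ω : Outcome N | k < ω.2.2.1.2} ∩
      (fun ω : Outcome N => ω.2.2.2.2) ⁻¹' {u | (u (k, n) : ℕ) = n} := by
    ext ω
    simp [colChange]
  rw [this]
  refine MeasurableSet.iUnion fun k => MeasurableSet.inter ?_ ?_
  · exact measurableSet_lt measurable_const (by fun_prop)
  · exact (by fun_prop : Measurable fun ω : Outcome N => ω.2.2.2.2) (measurable_hit k n)

lemma measurableSet_exists_hit (θ n : ℕ) :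
    MeasurableSet {u : HitArray | ∃ k < θ, (u (k, n) : ℕ) = n} := by
  have : {u : HitArray | ∃ k < θ, (u (k, n) : ℕ) = n} =
      ⋃ k ∈ Finset.range θ, {u : HitArray | (u (k, n) : ℕ) = n} := by
    ext u
    simp
  rw [this]
  exact Finset.measurableSet_biUnion _ fun k _ => measurable_hit k n

lemma law_rowChange_le (N n P : ℕ) :
    ∫⁻ ω, (rowChange N n).indicator 1 ω ∂(law N P) ≤ P * ((n : ℝ≥0∞) + 1)⁻¹ := by
  refine lintegral_law_le_of_forall fun q τ a ha b _ => ?_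
  calc _ = ∫⁻ ur, {u : HitArray | ∃ k < a, (u (k, n) : ℕ) = n}.indicator 1 ur ∂hitLaw := by
        refine lintegral_congr fun ur => ?_
        change ∫⁻ _, {u : HitArray | ∃ k < a, (u (k, n) : ℕ) = n}.indicator 1 ur ∂hitLaw = _
        simp
    _ ≤ a * ((n : ℝ≥0∞) + 1)⁻¹ := by
        rw [lintegral_indicator_one (measurableSet_exists_hit a n)]
        exact hitLaw_exists_hit_le a n
    _ ≤ _ := by gcongr

lemma law_colChange_le (N n P : ℕ) :
    ∫⁻ ω, (colChange N n).indicator 1 ω ∂(law N P) ≤ P * ((n : ℝ≥0∞) + 1)⁻¹ := by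
  refine lintegral_law_le_of_forall fun q τ a _ b hb => ?_
  calc _ = ∫⁻ _, ∫⁻ uc, {u : HitArray | ∃ k < b, (u (k, n) : ℕ) = n}.indicator 1 uc
        ∂hitLaw ∂hitLaw := rfl
    _ = ∫⁻ uc, {u : HitArray | ∃ k < b, (u (k, n) : ℕ) = n}.indicator 1 uc ∂hitLaw := by simp
    _ ≤ b * ((n : ℝ≥0∞) + 1)⁻¹ := by
        rw [lintegral_indicator_one (measurableSet_exists_hit b n)]
        exact hitLaw_exists_hit_le b n
    _ ≤ _ := by gcongr

variable {F : Type*} [Field F] {N n : ℕ}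

/-- Replacing the support of the new column by a tuple of independent uniform indices. -/
lemma lintegral_matT_newSupport_le (J : Template F N) (τ : Equiv.Perm (Fin N)) {d p : ℝ}
    (hd : 0 ≤ d) (hp : p * n ≤ d) (hN : n + 1 ≤ N) {c : ℝ≥0∞}
    (Ψ : Matrix (Fin n) (Fin n) F → Finset (Fin n) → ℝ≥0∞)
    (hΨ : ∀ A k, tupleAvg k (Ψ A) ≤ k * c) :
    ∫⁻ q, Ψ (matT J q τ p n (n.le_succ.trans hN)) (newSupport q τ p hN)
        ∂(Measure.infinitePi fun _ : ℕ × ℕ => (volume : Measure unitInterval)) ≤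
      ENNReal.ofReal (d * Real.exp d) * c := by
  classical
  set μ := Measure.infinitePi fun _ : ℕ × ℕ => (volume : Measure unitInterval)
  have hmeas : ∀ s : Finset (Fin n), Measurable fun q => if s ⊆ newSupport q τ p hN then
      Ψ (matT J q τ p n (n.le_succ.trans hN)) s else 0 := fun s =>
    measurable_comp_matT J τ p hN fun A S => if s ⊆ S then Ψ A s else 0
  have hmeas' : ∀ s : Finset (Fin n), Measurable fun q =>
      ENNReal.ofReal p ^ s.card * Ψ (matT J q τ p n (n.le_succ.trans hN)) s := fun s =>
    measurable_comp_matT J τ p hN fun A _ => ENNReal.ofReal p ^ s.card * Ψ A s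
  calc ∫⁻ q, Ψ (matT J q τ p n (n.le_succ.trans hN)) (newSupport q τ p hN) ∂μ
      ≤ ∫⁻ q, ∑ s : Finset (Fin n), (if s ⊆ newSupport q τ p hN then
          Ψ (matT J q τ p n (n.le_succ.trans hN)) s else 0) ∂μ := by
        refine lintegral_mono fun q => ?_
        -- The term with `s` equal to the new support already gives the integrand. Covering `s`
        -- instead of equalling it leaves only factors of edge presence.
        refine le_trans (le_of_eq ?_) (Finset.single_le_sum (fun _ _ => zero_le)
          (Finset.mem_univ (newSupport q τ p hN)))
        simp
    _ = ∑ s : Finset (Fin n), ∫⁻ q, (if s ⊆ newSupport q τ p hN then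
          Ψ (matT J q τ p n (n.le_succ.trans hN)) s else 0) ∂μ :=
        lintegral_finsetSum _ fun s _ => hmeas s
    _ ≤ ∑ s : Finset (Fin n), ∫⁻ q, ENNReal.ofReal p ^ s.card *
          Ψ (matT J q τ p n (n.le_succ.trans hN)) s ∂μ := by
        refine Finset.sum_le_sum fun s _ => ?_
        rw [lintegral_const_mul' _ _ (by finiteness)]
        exact lintegral_newSupport_le J τ p hN s fun A => Ψ A s
    _ = ∫⁻ q, ∑ s : Finset (Fin n), ENNReal.ofReal p ^ s.card *
          Ψ (matT J q τ p n (n.le_succ.trans hN)) s ∂μ :=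
        (lintegral_finsetSum _ fun s _ => hmeas' s).symm
    _ ≤ ∫⁻ _, ENNReal.ofReal (d * Real.exp d) * c ∂μ := by
        refine lintegral_mono fun q => ?_
        refine (sum_pow_card_mul_le _ _).trans ?_
        calc _ ≤ ∑ k ∈ Finset.range (Fintype.card (Fin n) + 1),
              ENNReal.ofReal d ^ k / (k.factorial : ℝ≥0∞) * (k * c) := by
              gcongr with k _
              · rw [← ENNReal.ofReal_natCast, ← ENNReal.ofReal_mul' (by positivity),
                  Fintype.card_fin]
                exact ENNReal.ofReal_le_ofReal hp
              · exact hΨ _ k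
          _ ≤ _ := by
              simp_rw [← mul_assoc]
              rw [← Finset.sum_mul]
              gcongr
              exact sum_pow_div_factorial_mul_le hd _
    _ = _ := by simp [μ]

/-- Averaging over the perturbation and over the new column. -/
lemma lintegral_law_gap_le (J : Template F N) {d p : ℝ} (hd : 0 ≤ d) (hp : p * n ≤ d)
    (hn : 0 < n) (hN : n + 1 ≤ N) (P : ℕ) {c : ℝ≥0∞}
    (Ψ : Matrix (Fin n) (Fin n) F → Finset (Fin n) → Finset (Fin n) → Finset (Fin n) → ℝ≥0∞)
    (hΨ : ∀ A k, ∑ a ∈ Finset.Icc 1 P, ∑ b ∈ Finset.Icc 1 P,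
      (tupleAvg a fun R => tupleAvg b fun C => tupleAvg k fun S => Ψ A R C S) ≤ k * c) :
    ∫⁻ ω, Ψ (matT J ω.1 ω.2.1 p n (n.le_succ.trans hN)) (hitSet ω.2.2.2.1 ω.2.2.1.1 n)
        (hitSet ω.2.2.2.2 ω.2.2.1.2 n) (newSupport ω.1 ω.2.1 p hN) ∂(law N P) ≤
      ENNReal.ofReal (d * Real.exp d) * (((P : ℝ≥0∞) ^ 2)⁻¹ * c) := by
  set μ := Measure.infinitePi fun _ : ℕ × ℕ => (volume : Measure unitInterval)
  -- The perturbation is averaged out first, for fixed matrix and support; only then is the support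
  -- replaced by a tuple.
  let Ψ' : Matrix (Fin n) (Fin n) F → Finset (Fin n) → ℝ≥0∞ := fun A S =>
    ((P : ℝ≥0∞) ^ 2)⁻¹ * ∑ a ∈ Finset.Icc 1 P, ∑ b ∈ Finset.Icc 1 P,
      tupleAvg a fun R => tupleAvg b fun C => Ψ A R C S
  have hΨ' : ∀ A k, tupleAvg k (Ψ' A) ≤ k * (((P : ℝ≥0∞) ^ 2)⁻¹ * c) := by
    intro A k
    simp only [Ψ']
    rw [tupleAvg_mul_left, tupleAvg_sum, mul_left_comm]
    gcongr
    refine le_trans (le_of_eq ?_) (hΨ A k)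
    refine Finset.sum_congr rfl fun a _ => ?_
    rw [tupleAvg_sum]
    refine Finset.sum_congr rfl fun b _ => ?_
    rw [tupleAvg_comm]
    congr 1
    funext R
    rw [tupleAvg_comm]
  refine (lintegral_law_le N P _).trans ?_
  have hswap : ∀ (C : Finset (Fin n) → Finset (Fin n) → ℝ≥0∞) (a b : ℕ),
      ∫⁻ ur, tupleAvg b (C (hitSet ur a n)) ∂hitLaw =
        tupleAvg a fun R => tupleAvg b (C R) :=
    fun C a b => lintegral_hitSet hn a fun R => tupleAvg b (C R)
  calc _ = ∫⁻ q, ∫⁻ τ, Ψ' (matT J q τ p n (n.le_succ.trans hN)) (newSupport q τ p hN)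
        ∂(uniformOn (Set.univ : Set (Equiv.Perm (Fin N)))) ∂μ := by
        refine lintegral_congr fun q => lintegral_congr fun τ => ?_
        simp only [Ψ']
        congr 1
        refine Finset.sum_congr rfl fun a _ => Finset.sum_congr rfl fun b _ => ?_
        refine Eq.trans (lintegral_congr fun ur => ?_) (hswap (fun R C =>
          Ψ (matT J q τ p n (n.le_succ.trans hN)) R C (newSupport q τ p hN)) a b)
        exact lintegral_hitSet hn b fun C => Ψ (matT J q τ p n (n.le_succ.trans hN))
          (hitSet ur a n) C (newSupport q τ p hN)
    _ = ∑ τ, (∫⁻ q, Ψ' (matT J q τ p n (n.le_succ.trans hN)) (newSupport q τ p hN) ∂μ) *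
          uniformOn (Set.univ : Set (Equiv.Perm (Fin N))) {τ} := by
        simp_rw [lintegral_fintype]
        rw [lintegral_finsetSum _ fun τ _ => (measurable_comp_matT J τ p hN Ψ').mul_const _]
        exact Finset.sum_congr rfl fun τ _ =>
          lintegral_mul_const _ (measurable_comp_matT J τ p hN Ψ')
    _ ≤ ∑ τ, (ENNReal.ofReal (d * Real.exp d) * (((P : ℝ≥0∞) ^ 2)⁻¹ * c)) *
          uniformOn (Set.univ : Set (Equiv.Perm (Fin N))) {τ} := by
        gcongr with τ
        exact lintegral_matT_newSupport_le J τ hd hp hN Ψ' hΨ'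
    _ = _ := by
        rw [← lintegral_fintype]
        simp

end LawIntegral

/-! ### From gap sets to the proportions of the types. -/

section Stability

variable {F : Type*} [Field F] {N n : ℕ}

/-- The indices frozen modulo `R` and `C`. -/
noncomputable def frozenFinset (T : Matrix (Fin n) (Fin n) F) (R C : Finset (Fin n)) :
    Finset (Fin n) :=
  open Classical in {i | FrozenMod T R C i}

/-- The indices firmly frozen modulo `R` and `C`. -/
noncomputable def firmFinset (T : Matrix (Fin n) (Fin n) F) (R C : Finset (Fin n)) :
    Finset (Fin n) :=
  open Classical in {i | FrozenMod T R (C ∪ {i}) i}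

lemma mem_frozenFinset {T : Matrix (Fin n) (Fin n) F} {R C : Finset (Fin n)} {i : Fin n} :
    i ∈ frozenFinset T R C ↔ FrozenMod T R C i := by
  simp [frozenFinset]

lemma mem_firmFinset {T : Matrix (Fin n) (Fin n) F} {R C : Finset (Fin n)} {i : Fin n} :
    i ∈ firmFinset T R C ↔ FrozenMod T R (C ∪ {i}) i := by
  simp [firmFinset]

lemma frozenFinset_mono (T : Matrix (Fin n) (Fin n) F) {R R' C C' : Finset (Fin n)}
    (hR : R ⊆ R') (hC : C' ⊆ C) : frozenFinset T R C ⊆ frozenFinset T R' C' := fun _ hi =>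
  mem_frozenFinset.2 ((mem_frozenFinset.1 hi).mono hR hC)

lemma firmFinset_mono (T : Matrix (Fin n) (Fin n) F) {R R' C C' : Finset (Fin n)}
    (hR : R ⊆ R') (hC : C' ⊆ C) : firmFinset T R C ⊆ firmFinset T R' C' := fun _ hi =>
  mem_firmFinset.2 ((mem_firmFinset.1 hi).mono hR (Finset.union_subset_union_left hC))

/-- An upper bound for the number of indices whose type may change when a row and a column
supported in `S` are added. -/
noncomputable def typeGap (T : Matrix (Fin n) (Fin n) F) (R C S : Finset (Fin n)) : ℝ≥0∞ :=
  gap (frozenFinset T) R C S + gap (firmFinset T) R C S +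
    gap (frozenFinset T) C R S + gap (firmFinset T) C R S

lemma sum_tupleAvg_typeGap_le (T : Matrix (Fin n) (Fin n) F) (P k : ℕ) :
    ∑ a ∈ Finset.Icc 1 P, ∑ b ∈ Finset.Icc 1 P,
      (tupleAvg a fun R => tupleAvg b fun C => tupleAvg k fun S => typeGap T R C S) ≤
      k * (8 * P * n) := by
  simp only [typeGap, tupleAvg_add, Finset.sum_add_distrib]
  calc _ ≤ (2 * k * P * Fintype.card (Fin n) + 2 * k * P * Fintype.card (Fin n) +
        2 * k * P * Fintype.card (Fin n) + 2 * k * P * Fintype.card (Fin n) : ℝ≥0∞) := by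
        gcongr
        · exact sum_tupleAvg_gap_le (frozenFinset_mono T) P k
        · exact sum_tupleAvg_gap_le (firmFinset_mono T) P k
        · exact sum_tupleAvg_gap_swap_le (frozenFinset_mono T) P k
        · exact sum_tupleAvg_gap_swap_le (firmFinset_mono T) P k
    _ = _ := by
        rw [Fintype.card_fin]
        ring

/-- The labels whose frozen and firmly frozen status in `A` and `Aᵀ` satisfies `φ`. -/
def typeSet {r c : ℕ} (φ : Prop → Prop → Prop → Prop → Prop)
    (A : Matrix (Fin n ⊕ Fin r) (Fin n ⊕ Fin c) F) : Set (Fin n) :=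
  {i | φ (Sum.inl i ∈ frozen A) (FirmlyFrozen A i) (Sum.inl i ∈ frozen Aᵀ) (FirmlyFrozen Aᵀ i)}

lemma hitSet_succ {u : HitArray} {θ : ℕ} (hn : 0 < n)
    (h : ∀ k < θ, (u (k, n) : ℕ) ≠ n) :
    hitSet u θ (n + 1) = (hitSet u θ n).map Fin.castSuccEmb := by
  ext j
  simp only [mem_hitSet, Finset.mem_map, Fin.coe_castSuccEmb]
  constructor
  · rintro ⟨k, hk⟩
    rw [lastHit_succ (h k k.2)] at hk
    exact ⟨⟨lastHit u k n, lastHit_lt hn u k⟩, ⟨k, rfl⟩, Fin.ext hk.symm⟩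
  · rintro ⟨i, ⟨k, hk⟩, rfl⟩
    exact ⟨k, by rw [lastHit_succ (h k k.2)]; exact hk⟩

/-- Both statuses are implied by the one modulo `(R, C ∪ S)` and imply the one modulo `(R ∪ S, C)`.
They can differ only where the former fails and the latter holds. -/
lemma mem_gap_of_border {B : Matrix (Fin (n + 1)) (Fin (n + 1)) F} (hB : Bᵀ = B)
    {R C S : Finset (Fin n)} {i : Fin n} (hS : ∀ k ∉ S, B k.castSucc (Fin.last n) = 0)
    (h : ¬(FrozenMod (B.submatrix Fin.castSucc Fin.castSucc) R C i ↔
      FrozenMod B (R.map Fin.castSuccEmb) (C.map Fin.castSuccEmb) i.castSucc)) :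
    FrozenMod (B.submatrix Fin.castSucc Fin.castSucc) (R ∪ S) C i ∧
      ¬FrozenMod (B.submatrix Fin.castSucc Fin.castSucc) R (C ∪ S) i := by
  have hS' : ∀ k ∉ S, B (Fin.last n) k.castSucc = 0 := fun k hk => by
    rw [← hB, Matrix.transpose_apply]
    exact hS k hk
  constructor
  · by_contra hno
    exact h ⟨fun h1 => (hno (h1.mono Finset.subset_union_left subset_rfl)).elim,
      fun h1 => (hno (h1.of_border hS')).elim⟩
  · intro hyes
    exact h ⟨fun _ => hyes.border hS, fun _ => hyes.mono subset_rfl Finset.subset_union_left⟩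

/-- Unless the perturbation changes, the type of a label can only change on the gap sets. -/
lemma card_type_change_le (φ : Prop → Prop → Prop → Prop → Prop) (hn : 0 < n)
    {B : Matrix (Fin (n + 1)) (Fin (n + 1)) F} (hB : Bᵀ = B) {S : Finset (Fin n)}
    (hS : ∀ k ∉ S, B k.castSucc (Fin.last n) = 0) (θ : ℕ × ℕ) (ur uc : HitArray)
    (hr : ∀ k < θ.1, (ur (k, n) : ℕ) ≠ n) (hc : ∀ k < θ.2, (uc (k, n) : ℕ) ≠ n) :
    ((symmDiff (typeSet φ (perturb (B.submatrix Fin.castSucc Fin.castSucc) θ ur uc))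
      (Fin.castSucc ⁻¹' typeSet φ (perturb B θ ur uc))).ncard : ℝ≥0∞) ≤
      typeGap (B.submatrix Fin.castSucc Fin.castSucc) (hitSet ur θ.1 n) (hitSet uc θ.2 n) S := by
  classical
  set T := B.submatrix Fin.castSucc Fin.castSucc with hTdef
  have hT : Tᵀ = T := by rw [hTdef, Matrix.transpose_submatrix, hB]
  set R := hitSet ur θ.1 n with hRdef
  set C := hitSet uc θ.2 n with hCdef
  have hlr : ∀ m, 0 < m → ∀ k, lastHit ur k m < m := fun m hm k => lastHit_lt hm ur k
  have hlc : ∀ m, 0 < m → ∀ k, lastHit uc k m < m := fun m hm k => lastHit_lt hm uc k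
  have hR' : hitSet ur θ.1 (n + 1) = R.map Fin.castSuccEmb := hitSet_succ hn hr
  have hC' : hitSet uc θ.2 (n + 1) = C.map Fin.castSuccEmb := hitSet_succ hn hc
  have hmap : ∀ (D : Finset (Fin n)) (i : Fin n),
      D.map Fin.castSuccEmb ∪ {i.castSucc} = (D ∪ {i}).map Fin.castSuccEmb := by
    intro D i
    rw [Finset.map_union, Finset.map_singleton, Fin.coe_castSuccEmb]
  let D : Finset (Fin n) :=
    (frozenFinset T (R ∪ S) C \ frozenFinset T R (C ∪ S)) ∪
    (firmFinset T (R ∪ S) C \ firmFinset T R (C ∪ S)) ∪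
    (frozenFinset T (C ∪ S) R \ frozenFinset T C (R ∪ S)) ∪
    (firmFinset T (C ∪ S) R \ firmFinset T C (R ∪ S))
  have hsub : symmDiff (typeSet φ (perturb T θ ur uc))
      (Fin.castSucc ⁻¹' typeSet φ (perturb B θ ur uc)) ⊆ (D : Set (Fin n)) := by
    intro i hi
    by_contra hD
    simp only [D, Finset.coe_union, Finset.coe_sdiff, Set.mem_union, Set.mem_sdiff, Finset.mem_coe,
      not_or, mem_frozenFinset, mem_firmFinset] at hD
    obtain ⟨⟨⟨h1, h2⟩, h3⟩, h4⟩ := hD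
    have e1 : (Sum.inl i ∈ frozen (perturb T θ ur uc)) =
        (Sum.inl i.castSucc ∈ frozen (perturb B θ ur uc)) := by
      rw [mem_frozen_perturb_iff _ _ _ _ (hlc n hn),
        mem_frozen_perturb_iff _ _ _ _ (hlc _ n.succ_pos), hR', hC', eq_iff_iff]
      by_contra h
      exact h1 (mem_gap_of_border hB hS h)
    have e2 : FirmlyFrozen (perturb T θ ur uc) i =
        FirmlyFrozen (perturb B θ ur uc) i.castSucc := by
      rw [firmlyFrozen_perturb_iff _ _ _ _ (hlc n hn),
        firmlyFrozen_perturb_iff _ _ _ _ (hlc _ n.succ_pos), hR', hC', hmap, eq_iff_iff]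
      by_contra h
      have := mem_gap_of_border hB hS h
      -- The sandwich was applied with `C ∪ {i}` for `C`; reordering the union gives the gap of
      -- `firmFinset`.
      rw [Finset.union_right_comm] at this
      exact h2 this
    have e3 : (Sum.inl i ∈ frozen (perturb T θ ur uc)ᵀ) =
        (Sum.inl i.castSucc ∈ frozen (perturb B θ ur uc)ᵀ) := by
      rw [transpose_perturb, transpose_perturb, hT, hB,
        mem_frozen_perturb_iff _ _ _ _ (hlr n hn),
        mem_frozen_perturb_iff _ _ _ _ (hlr _ n.succ_pos), Prod.fst_swap, Prod.snd_swap, hR', hC',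
        eq_iff_iff]
      by_contra h
      exact h3 (mem_gap_of_border hB hS h)
    have e4 : FirmlyFrozen (perturb T θ ur uc)ᵀ i =
        FirmlyFrozen (perturb B θ ur uc)ᵀ i.castSucc := by
      rw [transpose_perturb, transpose_perturb, hT, hB,
        firmlyFrozen_perturb_iff _ _ _ _ (hlr n hn),
        firmlyFrozen_perturb_iff _ _ _ _ (hlr _ n.succ_pos), Prod.fst_swap, Prod.snd_swap, hR',
        hC', hmap, eq_iff_iff]
      by_contra h
      have := mem_gap_of_border hB hS h
      rw [Finset.union_right_comm] at this
      exact h4 this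
    simp only [Set.mem_symmDiff, typeSet, Set.mem_preimage, Set.mem_ofPred_eq, e1, e2, e3, e4] at hi
    rcases hi with hi | hi <;> exact hi.2 hi.1
  calc ((symmDiff (typeSet φ (perturb T θ ur uc))
        (Fin.castSucc ⁻¹' typeSet φ (perturb B θ ur uc))).ncard : ℝ≥0∞) ≤ (D.card : ℝ≥0∞) := by
        rw [← Set.ncard_coe_finset]
        exact Nat.cast_le.2 (Set.ncard_le_ncard hsub (Finset.finite_toSet D))
    _ ≤ _ := by
        unfold typeGap gap
        norm_cast
        refine (Finset.card_union_le _ _).trans (Nat.add_le_add_right ?_ _)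
        refine (Finset.card_union_le _ _).trans (Nat.add_le_add_right ?_ _)
        exact Finset.card_union_le _ _

lemma transpose_matT (J : Template F N) (q : ℕ × ℕ → unitInterval) (τ : Equiv.Perm (Fin N))
    (p : ℝ) (m : ℕ) (hm : m ≤ N) : (matT J q τ p m hm)ᵀ = matT J q τ p m hm := by
  ext i j
  simp only [matT, Matrix.transpose_apply, Matrix.of_apply]
  rcases lt_trichotomy i j with h | h | h
  · simp [h, h.not_gt]
  · simp [h]
  · simp [h, h.not_gt]

lemma matT_submatrix (J : Template F N) (q : ℕ × ℕ → unitInterval) (τ : Equiv.Perm (Fin N))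
    (p : ℝ) (hN : n + 1 ≤ N) :
    (matT J q τ p (n + 1) hN).submatrix Fin.castSucc Fin.castSucc =
      matT J q τ p n (n.le_succ.trans hN) := rfl

lemma matT_last_eq_zero (J : Template F N) (q : ℕ × ℕ → unitInterval) (τ : Equiv.Perm (Fin N))
    (p : ℝ) (hN : n + 1 ≤ N) {i : Fin n} (hi : i ∉ newSupport q τ p hN) :
    matT J q τ p (n + 1) hN i.castSucc (Fin.last n) = 0 := by
  rw [mem_newSupport] at hi
  simp only [matT, Matrix.of_apply]
  rw [if_pos (Fin.castSucc_lt_last i), if_neg hi]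

lemma abs_ncard_div_sub_le (hn : 0 < n) (V : Set (Fin n)) (W : Set (Fin (n + 1))) :
    |(V.ncard : ℝ) / n - (W.ncard : ℝ) / ((n + 1 : ℕ) : ℝ)| ≤
      ((symmDiff V (Fin.castSucc ⁻¹' W)).ncard : ℝ) / n + 1 / (n + 1) := by
  set W' := Fin.castSucc ⁻¹' W
  set g := (symmDiff V W').ncard
  have hV : V.ncard ≤ W'.ncard + g := by
    refine (Set.ncard_le_ncard ?_).trans (Set.ncard_union_le _ _)
    intro i hi
    by_cases h : i ∈ W'
    exacts [Or.inl h, Or.inr (Or.inl ⟨hi, h⟩)]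
  have hW' : W'.ncard ≤ V.ncard + g := by
    refine (Set.ncard_le_ncard ?_).trans (Set.ncard_union_le _ _)
    intro i hi
    by_cases h : i ∈ V
    exacts [Or.inl h, Or.inr (Or.inr ⟨hi, h⟩)]
  have himg : (Fin.castSucc '' W').ncard = W'.ncard :=
    Set.ncard_image_of_injective _ (Fin.castSucc_injective n)
  have h1 : W'.ncard ≤ W.ncard := by
    rw [← himg]
    exact Set.ncard_le_ncard (Set.image_preimage_subset _ _)
  have h2 : W.ncard ≤ W'.ncard + 1 := by
    have : W ⊆ insert (Fin.last n) (Fin.castSucc '' W') := by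
      intro i hi
      induction i using Fin.lastCases with
      | last => exact Or.inl rfl
      | cast i => exact Or.inr ⟨i, hi, rfl⟩
    exact (Set.ncard_le_ncard this).trans ((Set.ncard_insert_le _ _).trans (by rw [himg]))
  have h3 : W'.ncard ≤ n := by
    simpa using Set.ncard_le_ncard (Set.subset_univ W')
  have hn' : (0 : ℝ) < n := by exact_mod_cast hn
  have k1 : (V.ncard : ℝ) ≤ W'.ncard + g := by exact_mod_cast hV
  have k2 : (W'.ncard : ℝ) ≤ V.ncard + g := by exact_mod_cast hW'
  have k3 : (W'.ncard : ℝ) ≤ W.ncard := by exact_mod_cast h1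
  have k4 : (W.ncard : ℝ) ≤ W'.ncard + 1 := by exact_mod_cast h2
  have k5 : (W'.ncard : ℝ) ≤ n := by exact_mod_cast h3
  have k6 : (0 : ℝ) ≤ W'.ncard := by positivity
  push_cast
  -- The second numerator is a difference of two numbers in `[0, 1]`: it collects the new
  -- normalisation and the new label.
  have hsplit : (V.ncard : ℝ) / n - W.ncard / (n + 1) =
      (V.ncard - W'.ncard) / n + (W'.ncard / n - (W.ncard - W'.ncard)) / (n + 1) := by
    field_simp
    ring
  have hq : (W'.ncard : ℝ) / n ≤ 1 := (div_le_one hn').2 k5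
  have hq0 : (0 : ℝ) ≤ W'.ncard / n := by positivity
  rw [hsplit]
  refine (abs_add_le _ _).trans (add_le_add ?_ ?_)
  · rw [abs_div, abs_of_pos hn']
    gcongr
    rw [abs_le]
    constructor <;> linarith
  · rw [abs_div, abs_of_pos (by positivity : (0 : ℝ) < n + 1)]
    gcongr
    rw [abs_le]
    constructor <;> linarith

lemma ncard_div_mem_Icc (m : ℕ) (V : Set (Fin m)) : (V.ncard : ℝ) / m ∈ Set.Icc (0 : ℝ) 1 := by
  have : (V.ncard : ℝ) ≤ m := by
    exact_mod_cast (by simpa using Set.ncard_le_ncard (Set.subset_univ V) : V.ncard ≤ m)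
  exact ⟨by positivity, div_le_one_of_le₀ this (by positivity)⟩

/-- A pointwise bound for the change of any proportion. -/
noncomputable def changeBound (J : Template F N) (p : ℝ) (hN : n + 1 ≤ N) (ω : Outcome N) :
    ℝ≥0∞ :=
  (rowChange N n).indicator 1 ω + ((colChange N n).indicator 1 ω + (((n : ℝ≥0∞) + 1)⁻¹ +
    (n : ℝ≥0∞)⁻¹ * typeGap (matT J ω.1 ω.2.1 p n (n.le_succ.trans hN))
      (hitSet ω.2.2.2.1 ω.2.2.1.1 n) (hitSet ω.2.2.2.2 ω.2.2.1.2 n)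
      (newSupport ω.1 ω.2.1 p hN)))

/-- If a perturbation position moves, the trivial bound `1` is paid by an indicator; otherwise the
gap bound applies. -/
lemma enorm_change_le (φ : Prop → Prop → Prop → Prop → Prop) (hn : 0 < n) (J : Template F N)
    (p : ℝ) (hN : n + 1 ≤ N) (ω : Outcome N) :
    ENNReal.ofReal |((typeSet φ (matTθ J p n (n.le_succ.trans hN) ω)).ncard : ℝ) / n -
      ((typeSet φ (matTθ J p (n + 1) hN ω)).ncard : ℝ) / ((n + 1 : ℕ) : ℝ)| ≤
      changeBound J p hN ω := by
  set V := typeSet φ (matTθ J p n (n.le_succ.trans hN) ω) with hV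
  set W := typeSet φ (matTθ J p (n + 1) hN ω) with hW
  have hone : ENNReal.ofReal |(V.ncard : ℝ) / n - (W.ncard : ℝ) / ((n + 1 : ℕ) : ℝ)| ≤ 1 := by
    rw [ENNReal.ofReal_le_one, abs_le]
    have h1 := ncard_div_mem_Icc n V
    have h2 := ncard_div_mem_Icc (n + 1) W
    constructor <;> linarith [h1.1, h1.2, h2.1, h2.2]
  by_cases hr : ω ∈ rowChange N n
  · refine hone.trans ?_
    rw [changeBound, Set.indicator_of_mem hr]
    exact le_self_add
  by_cases hc : ω ∈ colChange N n
  · refine hone.trans ?_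
    rw [changeBound, Set.indicator_of_mem hc]
    exact le_self_add.trans le_add_self
  simp only [rowChange, colChange, Set.mem_ofPred_eq, not_exists, not_and] at hr hc
  have hn' : (0 : ℝ) < n := by exact_mod_cast hn
  have hcard := card_type_change_le φ hn (transpose_matT J ω.1 ω.2.1 p (n + 1) hN)
    (fun k hk => matT_last_eq_zero J ω.1 ω.2.1 p hN hk) ω.2.2.1 ω.2.2.2.1 ω.2.2.2.2 hr hc
  rw [matT_submatrix] at hcard
  refine (ENNReal.ofReal_le_ofReal (abs_ncard_div_sub_le hn V W)).trans ?_
  rw [ENNReal.ofReal_add (by positivity) (by positivity), ENNReal.ofReal_div_of_pos hn',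
    ENNReal.ofReal_natCast, ENNReal.ofReal_natCast, one_div,
    ENNReal.ofReal_inv_of_pos (by positivity), ENNReal.ofReal_add hn'.le zero_le_one,
    ENNReal.ofReal_natCast, ENNReal.ofReal_one, add_comm, div_eq_mul_inv, mul_comm (_ : ℝ≥0∞) _⁻¹]
  refine le_trans ?_ (le_add_self.trans le_add_self)
  gcongr
  exact hcard

/-- The factor `2 * P + 1` comes from the two moving events and the new label, the `8` from four
gaps worth `2kPn` each. -/
lemma lintegral_changeBound_le (J : Template F N) {d p : ℝ} (hd : 0 ≤ d) (hp : p * n ≤ d)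
    (hn : 0 < n) (hN : n + 1 ≤ N) {P : ℕ} (hP : 0 < P) :
    ∫⁻ ω, changeBound J p hN ω ∂(law N P) ≤
      (2 * P + 1) * ((n : ℝ≥0∞) + 1)⁻¹ + 8 * ENNReal.ofReal (d * Real.exp d) * (P : ℝ≥0∞)⁻¹ := by
  have hn0 : (n : ℝ≥0∞) ≠ 0 := by simpa using hn.ne'
  have hP0 : (P : ℝ≥0∞) ≠ 0 := by simpa using hP.ne'
  unfold changeBound
  rw [lintegral_add_left (measurable_one.indicator (measurableSet_rowChange N n)),
    lintegral_add_left (measurable_one.indicator (measurableSet_colChange N n)),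
    lintegral_add_left measurable_const, lintegral_const_mul' _ _ (by simpa using hn.ne')]
  have hconst : ∫⁻ _ω, ((n : ℝ≥0∞) + 1)⁻¹ ∂(law N P) ≤ ((n : ℝ≥0∞) + 1)⁻¹ :=
    lintegral_law_le_of_forall fun _ _ _ _ _ _ => by simp
  calc _ ≤ P * ((n : ℝ≥0∞) + 1)⁻¹ + (P * ((n : ℝ≥0∞) + 1)⁻¹ + (((n : ℝ≥0∞) + 1)⁻¹ +
        (n : ℝ≥0∞)⁻¹ * (ENNReal.ofReal (d * Real.exp d) *
          (((P : ℝ≥0∞) ^ 2)⁻¹ * (8 * P * n))))) := by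
        gcongr
        · exact law_rowChange_le N n P
        · exact law_colChange_le N n P
        · exact lintegral_law_gap_le J hd hp hn hN P typeGap
            fun A k => sum_tupleAvg_typeGap_le A P k
    _ = (2 * P + 1) * ((n : ℝ≥0∞) + 1)⁻¹ + 8 * ENNReal.ofReal (d * Real.exp d) *
        (P : ℝ≥0∞)⁻¹ * ((n : ℝ≥0∞)⁻¹ * n) * ((P : ℝ≥0∞)⁻¹ * P) := by
        rw [ENNReal.inv_pow]
        ring
    _ = _ := by
        rw [ENNReal.inv_mul_cancel hn0 (by finiteness), ENNReal.inv_mul_cancel hP0 (by finiteness),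
          mul_one, mul_one]

/-- The order of limits matters: `n → ∞` removes `(2P + 1)/(n + 1)` for fixed `P`, then `P → ∞`
removes the gap term. The factor `5` leaves room for the five coordinates of `propZeta`. -/
lemma isLittleOneNP_of_le {d : ℝ} (hd : 0 ≤ d)
    {a : (n P N : ℕ) → n + 1 ≤ N → Template F N → ℝ → ℝ≥0∞}
    (h : ∀ n P N (hN : n + 1 ≤ N) J t, 0 < n →
      a n P N hN J t ≤ 5 * ∫⁻ ω, changeBound J (t / n) hN ω ∂(law N P)) :
    IsLittleOneNP d a := by
  set K : ℝ≥0∞ := 8 * ENNReal.ofReal (d * Real.exp d)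
  have hK : K ≠ ⊤ := by finiteness
  have hinner : ∀ P : ℕ, 0 < P → limsup (fun n : ℕ =>
      ⨆ (N : ℕ) (hN : n + 1 ≤ N) (J : Template F N) (t : ℝ) (_ : t ∈ Set.Icc 0 d),
        a n P N hN J t) atTop ≤ 5 * (K * (P : ℝ≥0∞)⁻¹) := by
    intro P hP
    have hlim : Tendsto (fun n : ℕ => 5 * ((2 * P + 1) * ((n : ℝ≥0∞) + 1)⁻¹ + K * (P : ℝ≥0∞)⁻¹))
        atTop (nhds (5 * ((2 * P + 1) * 0 + K * (P : ℝ≥0∞)⁻¹))) := by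
      have h1 : Tendsto (fun n : ℕ => ((n : ℝ≥0∞) + 1)⁻¹) atTop (nhds 0) := by
        have := (tendsto_add_atTop_iff_nat 1).2 ENNReal.tendsto_inv_nat_nhds_zero
        simpa using this
      exact ENNReal.Tendsto.const_mul ((ENNReal.Tendsto.const_mul h1
        (Or.inr (by finiteness))).add tendsto_const_nhds) (Or.inr (by finiteness))
    rw [mul_zero, zero_add] at hlim
    rw [← hlim.limsup_eq]
    refine limsup_le_limsup ?_
    filter_upwards [eventually_gt_atTop 0] with n hn
    refine iSup_le fun N => iSup_le fun hN => iSup_le fun J => iSup_le fun t => iSup_le fun ht => ?_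
    refine (h n P N hN J t hn).trans ?_
    gcongr
    refine lintegral_changeBound_le J hd ?_ hn hN hP
    rw [div_mul_cancel₀ _ (by positivity)]
    exact ht.2
  have hlim : Tendsto (fun P : ℕ => 5 * (K * (P : ℝ≥0∞)⁻¹)) atTop (nhds 0) := by
    have := ENNReal.Tendsto.const_mul (a := 5) (ENNReal.Tendsto.const_mul (a := K)
      ENNReal.tendsto_inv_nat_nhds_zero (Or.inr hK)) (Or.inr (by finiteness))
    simpa using this
  refine le_antisymm ?_ zero_le
  rw [← hlim.limsup_eq]
  refine limsup_le_limsup ?_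
  filter_upwards [eventually_gt_atTop 0] with P hP
  exact hinner P hP

lemma isLittleOneNP_expectedChange {E : Type*} [NormedAddCommGroup E] {d : ℝ} (hd : 0 ≤ d)
    (w : ∀ {n r c : ℕ}, Matrix (Fin n ⊕ Fin r) (Fin n ⊕ Fin c) F → E)
    (h : ∀ (n N : ℕ) (hN : n + 1 ≤ N) (J : Template F N) (p : ℝ) (ω : Outcome N), 0 < n →
      ‖w (matTθ J p n (n.le_succ.trans hN) ω) - w (matTθ J p (n + 1) hN ω)‖ₑ ≤
        5 * changeBound J p hN ω) :
    IsLittleOneNP (F := F) d (expectedChange w) := by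
  refine isLittleOneNP_of_le hd fun n P N hN J t hn => ?_
  rw [← lintegral_const_mul' _ _ (by finiteness)]
  exact lintegral_mono fun ω => h n N hN J (t / n) ω hn

lemma enorm_prop_change_le (φ : Prop → Prop → Prop → Prop → Prop) (hn : 0 < n) (J : Template F N)
    (p : ℝ) (hN : n + 1 ≤ N) (ω : Outcome N) :
    ‖((typeSet φ (matTθ J p n (n.le_succ.trans hN) ω)).ncard : ℝ) / n -
      ((typeSet φ (matTθ J p (n + 1) hN ω)).ncard : ℝ) / ((n + 1 : ℕ) : ℝ)‖ₑ ≤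
      changeBound J p hN ω := by
  rw [Real.enorm_eq_ofReal_abs]
  exact enorm_change_le φ hn J p hN ω

end Stability

end SymRank

theorem mainTheorem8 {F : Type*} [Field F] (d : ℝ) (hd : 0 < d) :
    SymRank.IsLittleOneNP (F := F) d (SymRank.expectedChange SymRank.propX) ∧
    SymRank.IsLittleOneNP (F := F) d (SymRank.expectedChange SymRank.propY) ∧
    SymRank.IsLittleOneNP (F := F) d (SymRank.expectedChange SymRank.propZ) ∧
    SymRank.IsLittleOneNP (F := F) d (SymRank.expectedChange SymRank.propU) ∧
    SymRank.IsLittleOneNP (F := F) d (SymRank.expectedChange SymRank.propV) ∧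
    SymRank.IsLittleOneNP (F := F) d (SymRank.expectedChange SymRank.propZeta) := by
  have hle : ∀ x : ℝ≥0∞, x ≤ 5 * x := fun x => le_mul_of_one_le_left zero_le (by norm_num)
  -- The arguments of `φ` are frozen and firmly frozen in the matrix, then the same for its
  -- transpose.
  have hX {n N : ℕ} (hn : 0 < n) :=
    SymRank.enorm_prop_change_le (F := F) (N := N) (fun a b _ _ => a ∧ ¬b) hn
  have hY {n N : ℕ} (hn : 0 < n) :=
    SymRank.enorm_prop_change_le (F := F) (N := N) (fun _ b _ b' => b ∧ b') hn
  have hZ {n N : ℕ} (hn : 0 < n) :=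
    SymRank.enorm_prop_change_le (F := F) (N := N) (fun a _ a' _ => ¬a ∧ ¬a') hn
  have hU {n N : ℕ} (hn : 0 < n) :=
    SymRank.enorm_prop_change_le (F := F) (N := N) (fun a _ _ b' => ¬a ∧ b') hn
  have hV {n N : ℕ} (hn : 0 < n) :=
    SymRank.enorm_prop_change_le (F := F) (N := N) (fun _ b a' _ => b ∧ ¬a') hn
  refine ⟨SymRank.isLittleOneNP_expectedChange hd.le _ fun n N hN J p ω hn =>
      (hX hn J p hN ω).trans (hle _),
    SymRank.isLittleOneNP_expectedChange hd.le _ fun n N hN J p ω hn =>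
      (hY hn J p hN ω).trans (hle _),
    SymRank.isLittleOneNP_expectedChange hd.le _ fun n N hN J p ω hn =>
      (hZ hn J p hN ω).trans (hle _),
    SymRank.isLittleOneNP_expectedChange hd.le _ fun n N hN J p ω hn =>
      (hU hn J p hN ω).trans (hle _),
    SymRank.isLittleOneNP_expectedChange hd.le _ fun n N hN J p ω hn =>
      (hV hn J p hN ω).trans (hle _),
    SymRank.isLittleOneNP_expectedChange hd.le _ fun n N hN J p ω hn => ?_⟩
  rw [← ofReal_norm, PiLp.norm_eq_of_L1,
    ENNReal.ofReal_sum_of_nonneg fun _ _ => norm_nonneg _]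
  simp only [ofReal_norm, Fin.sum_univ_five]
  calc _ ≤ SymRank.changeBound J p hN ω + SymRank.changeBound J p hN ω + SymRank.changeBound J p hN ω +
        SymRank.changeBound J p hN ω + SymRank.changeBound J p hN ω :=
        add_le_add (add_le_add (add_le_add (add_le_add (hX hn J p hN ω) (hY hn J p hN ω))
          (hZ hn J p hN ω)) (hU hn J p hN ω)) (hV hn J p hN ω)
    _ = _ := by ring
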